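/- Let $K$ be a number field and let $S$ be a finite set of primes of $K$ containing all the infinite primes. Write $\mathcal{O}_S$ for the ring of $S$-integers of $K$, $\mathcal{U}_S=\mathcal{O}_S^\times$ for the group of $S$-units, and $\overline{K}_S=\prod_{v\in S}K_v$ for the product of the completions of $K$ at the primes in $S$, in which $K$ is embedded diagonally. For a nonzero ideal $\mathfrak{a}$ of $\mathcal{O}_S$, let $\mathbb{T}=\overline{K}_S/\mathfrak{a}$ be the quotient topological group, on which $\mathcal{U}_S$ acts by multiplication. Consider the following assertion for the pair $(K,S)$: $(\ast)$ If $\#S\geq 3$, then for every nonzero ideal $\mathfrak{a}$ of $\mathcal{O}_S$, every nonempty closed $\mathcal{U}_S$-invariant subset of $\mathbb{T}=\overline{K}_S/\mathfrak{a}$ contains a torsion element of $\mathbb{T}$. Let $K^+$ denote the maximal totally real subfield of $K$; $K$ is a CM-field if it is totally complex and $[K:K^+]=2$. **Proposition.** Suppose that $(\ast)$ holds for every pair $(K,S)$ except possibly those for which $K$ is a CM-field and distinct primes in $S$ lie over distinct primes of $K^+$. Then $(\ast)$ holds for every pair $(K,S)$. -/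

import Mathlib

open NumberField IsDedekindDomain

universe u

noncomputable section

/- Throughout, a finite set `S` of primes of `K` containing all the infinite primes is given by its
set `S₀` of finite primes, so that `S = S_∞ ∪ S₀`. -/

/-- The number of primes in `S = S_∞ ∪ S₀`. -/
def numPrimes (K : Type u) [Field K] [NumberField K] (S₀ : Finset (HeightOneSpectrum (𝓞 K))) : ℕ :=
  Fintype.card (InfinitePlace K) + S₀.card

/-- The ring `𝒪_S` of `S`-integers of `K`: the elements that are integral at every finite prime
outside of `S`. Its unit group `(SInt K S₀)ˣ` is the group `𝒰_S` of `S`-units. -/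
abbrev SInt (K : Type u) [Field K] [NumberField K] (S₀ : Finset (HeightOneSpectrum (𝓞 K))) :
    Subalgebra (𝓞 K) K :=
  (S₀ : Set (HeightOneSpectrum (𝓞 K))).integer K

/-- The product `∏_{v ∈ S} K_v` of the completions of `K` at the primes in `S`, with the product
topology. It is a `K`-algebra through the diagonal embedding. -/
abbrev SCompletion (K : Type u) [Field K] [NumberField K]
    (S₀ : Finset (HeightOneSpectrum (𝓞 K))) : Type u :=
  InfiniteAdeleRing K × ((v : S₀) → v.1.adicCompletion K)

/-- The image of an ideal `𝔞` of `𝒪_S` under the diagonal embedding. -/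
abbrev diagIdeal {K : Type u} [Field K] [NumberField K] {S₀ : Finset (HeightOneSpectrum (𝓞 K))}
    (𝔞 : Ideal (SInt K S₀)) : Submodule (SInt K S₀) (SCompletion K S₀) :=
  Submodule.map (Algebra.linearMap (SInt K S₀) (SCompletion K S₀)) 𝔞

/-- The topological group `𝕋 = (∏_{v ∈ S} K_v) / 𝔞`, with the quotient topology and the
multiplication action of `𝒪_S`, hence of its units. -/
abbrev STorus {K : Type u} [Field K] [NumberField K] {S₀ : Finset (HeightOneSpectrum (𝓞 K))}
    (𝔞 : Ideal (SInt K S₀)) : Type u :=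
  SCompletion K S₀ ⧸ diagIdeal 𝔞

/-- The torsion theorem for `(K, S)`: if `#S ≥ 3`, then for every nonzero ideal `𝔞` of `𝒪_S`, every
nonempty closed `𝒰_S`-invariant subset of `𝕋` contains a torsion element. -/
def TorsionTheorem (K : Type u) [Field K] [NumberField K]
    (S₀ : Finset (HeightOneSpectrum (𝓞 K))) : Prop :=
  3 ≤ numPrimes K S₀ →
    ∀ 𝔞 : Ideal (SInt K S₀), 𝔞 ≠ ⊥ →
      ∀ N : Set (STorus 𝔞), N.Nonempty → IsClosed N →
        (∀ ε : (SInt K S₀)ˣ, ∀ x ∈ N, ε • x ∈ N) →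
          ∃ x ∈ N, x ∈ AddCommGroup.torsion (STorus 𝔞)

/-- Distinct primes in `S` (infinite or finite) lie over distinct primes of `K⁺`, the maximal
totally real subfield of `K`. -/
def LieOverDistinct (K : Type u) [Field K] [NumberField K]
    (S₀ : Finset (HeightOneSpectrum (𝓞 K))) : Prop :=
  (∀ v w : InfinitePlace K,
    v.comap (algebraMap (maximalRealSubfield K) K) =
      w.comap (algebraMap (maximalRealSubfield K) K) → v = w) ∧
  (∀ v ∈ S₀, ∀ w ∈ S₀,
    v.asIdeal.under (𝓞 (maximalRealSubfield K)) =
      w.asIdeal.under (𝓞 (maximalRealSubfield K)) → v = w)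

end

open Filter Topology Set

/-! If K is not CM, the hypothesis applies as it stands. If K is CM with maximal totally real
subfield F, two cases arise, according to whether each finite prime of S is the only prime of K
above its restriction to F.

If so, S is the full preimage of a set S' of primes of F of the same size. The field F is totally
real, hence not CM, so (∗) holds for (F, S'). Writing K = F + αF with α integral makes an F-torus
squared map equivariantly onto 𝕋. Torsion points are found in its closed invariant sets one
coordinate at a time (`exists_mem_torsion_prod`, `torsionTheorem_of_quadratic`).

If not, some P in S has a second prime P' beside it over F. A generator of a power of P then has no
real power in any complex embedding (`pow_im_ne_zero`), so S-units rotate every complex factor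
irrationally, and (∗) is proved outright by a difference-set argument
(`IsExpanding.exists_mem_torsion`). Suppose N has no torsion point. Given n, pass to m-th powers of
units, which fix the n-torsion, and take a minimal invariant M inside N. A finite M would consist of
torsion points, so M is infinite, and D = M - M contains small elements with nonzero complex
components. Expansion turns these into an element of D lying on a single complex factor. Two
independent units give multipliers near 1, hence a half line in D. Rotation gives half lines in all
directions, so D is dense and closed (`IsExpanding.eq_univ`). Every n-torsion r is thus a difference
of points of M, and minimality gives M + r ⊆ M. Letting n vary, N contains a translate of the dense
torsion subgroup, hence 0, a contradiction. -/

/-! ### Powers and rotations of complex numbers -/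

lemma norm_one_add_pow_sub_le (δ : ℂ) (n : ℕ) :
    ‖(1 + δ) ^ n - 1 - n * δ‖ ≤ (1 + ‖δ‖) ^ n - 1 - n * ‖δ‖ := by
  induction n with
  | zero => simp
  | succ n ih =>
    have h1 : (1 + δ) ^ (n + 1) - 1 - ((n + 1 : ℕ) : ℂ) * δ =
        ((1 + δ) ^ n - 1 - n * δ) * (1 + δ) + n * δ ^ 2 := by push_cast; ring
    have h2 : (1 + ‖δ‖) ^ (n + 1) - 1 - ((n + 1 : ℕ) : ℝ) * ‖δ‖ =
        ((1 + ‖δ‖) ^ n - 1 - n * ‖δ‖) * (1 + ‖δ‖) + n * ‖δ‖ ^ 2 := by push_cast; ring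
    rw [h1, h2]
    refine (norm_add_le _ _).trans (add_le_add ?_ (by simp))
    rw [norm_mul]
    refine mul_le_mul ih ?_ (norm_nonneg _) ((norm_nonneg _).trans ih)
    simpa using norm_add_le (1 : ℂ) δ

/-- The worst case is the nonnegative real ‖δ‖, where (1 + ‖δ‖)^n ≤ exp(n‖δ‖) and the second-order
bound for exp applies. -/
lemma norm_one_add_pow_sub_le_sq (δ : ℂ) (n : ℕ) (h : n * ‖δ‖ ≤ 1) :
    ‖(1 + δ) ^ n - 1 - n * δ‖ ≤ (n * ‖δ‖) ^ 2 := by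
  refine (norm_one_add_pow_sub_le δ n).trans ?_
  have h0 : 0 ≤ n * ‖δ‖ := by positivity
  have h1 : (1 + ‖δ‖) ^ n ≤ Real.exp (n * ‖δ‖) := by
    rw [Real.exp_nat_mul]
    exact pow_le_pow_left₀ (by positivity) (by linarith [Real.add_one_le_exp ‖δ‖]) n
  have h2 := (abs_le.1 (Real.abs_exp_sub_one_sub_id_le (x := n * ‖δ‖) (by rwa [abs_of_nonneg h0]))).2
  linarith

/-- A power of a brings each b^k into the compact annulus 1 ≤ ‖z‖ ≤ ‖a‖. Two late terms of a
convergent subsequence have quotient near 1, and it is not 1 because the exponents of b differ. -/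
lemma exists_mem_near_one {G : Subgroup ℂˣ} {a b : ℂˣ} (ha : a ∈ G) (hb : b ∈ G)
    (ha1 : 1 < ‖(a : ℂ)‖) (hab : ∀ m k : ℤ, a ^ m * b ^ k = 1 → k = 0) {ε : ℝ} (hε : 0 < ε) :
    ∃ g ∈ G, g ≠ 1 ∧ ‖(g : ℂ) - 1‖ < ε := by
  have hex (k : ℕ) : ∃ m : ℤ, 1 ≤ ‖((a ^ m * b ^ (k : ℤ) : ℂˣ) : ℂ)‖ ∧
      ‖((a ^ m * b ^ (k : ℤ) : ℂˣ) : ℂ)‖ ≤ ‖(a : ℂ)‖ := by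
    have hb0 : 0 < ‖(b : ℂ) ^ k‖ := norm_pos_iff.2 (pow_ne_zero _ b.ne_zero)
    obtain ⟨m, hm1, hm2⟩ := exists_mem_Ico_zpow hb0 ha1
    have ha0 : 0 < ‖(a : ℂ)‖ := by linarith
    have hp : 0 < ‖(a : ℂ)‖ ^ m := zpow_pos ha0 m
    have hval : ‖((a ^ (-m) * b ^ (k : ℤ) : ℂˣ) : ℂ)‖ = (‖(a : ℂ)‖ ^ m)⁻¹ * ‖(b : ℂ) ^ k‖ := by
      simp
    refine ⟨-m, ?_, ?_⟩
    · rw [hval, inv_mul_eq_div, le_div_iff₀ hp, one_mul]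
      exact hm1
    · rw [hval, inv_mul_eq_div, div_le_iff₀ hp, ← zpow_one_add₀ ha0.ne', add_comm]
      exact hm2.le
  choose m hm1 hm2 using hex
  set f : ℕ → ℂˣ := fun k => a ^ m k * b ^ (k : ℤ) with hf
  have hball : ∀ k, (f k : ℂ) ∈ Metric.closedBall (0 : ℂ) ‖(a : ℂ)‖ := fun k => by
    rw [mem_closedBall_zero_iff]; exact hm2 k
  obtain ⟨z, -, ψ, hψ, hlim⟩ := (isCompact_closedBall (0 : ℂ) ‖(a : ℂ)‖).tendsto_subseq hball
  obtain ⟨N, hN⟩ := Metric.cauchySeq_iff.1 hlim.cauchySeq ε hε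
  have hd := hN (N + 1) (by omega) N le_rfl
  have hmem (k) : f k ∈ G := mul_mem (zpow_mem ha _) (zpow_mem hb _)
  refine ⟨f (ψ (N + 1)) * (f (ψ N))⁻¹, mul_mem (hmem _) (inv_mem (hmem _)), ?_, ?_⟩
  · intro h
    have h' : a ^ (m (ψ (N + 1)) - m (ψ N)) * b ^ ((ψ (N + 1) : ℤ) - ψ N) = 1 := by
      rw [← h]; simp only [hf, zpow_sub]; rw [mul_inv]; exact mul_mul_mul_comm ..
    have := hab _ _ h'
    have := hψ (Nat.lt_succ_self N)
    simp only [Nat.succ_eq_add_one] at this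
    omega
  · have h0 : (f (ψ N) : ℂ) ≠ 0 := (f (ψ N)).ne_zero
    have : ((f (ψ (N + 1)) * (f (ψ N))⁻¹ : ℂˣ) : ℂ) - 1 =
        ((f (ψ (N + 1)) : ℂ) - f (ψ N)) / f (ψ N) := by
      push_cast; field_simp
    rw [this, norm_div, div_lt_iff₀ (by positivity)]
    rw [dist_eq_norm] at hd
    exact hd.trans_le (le_mul_of_one_le_right hε.le (hm1 _))

/-- Rotations of a ray by the powers of a number none of whose powers is real fill up the plane
densely. -/
lemma eq_univ_of_rotation {S : Set ℂ} (hS : IsClosed S) {c : ℂˣ}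
    (hc : ∀ m : ℕ, 0 < m → ((c : ℂ) ^ m).im ≠ 0)
    (hrot : ∀ k : ℤ, ∀ w ∈ S, (c : ℂ) ^ k * w ∈ S)
    (hscale : ∀ t : ℝ, 0 ≤ t → ∀ w ∈ S, (t : ℂ) * w ∈ S) {w₀ : ℂ} (hw₀ : w₀ ∈ S) (h0 : w₀ ≠ 0) :
    S = univ := by
  set θ := Complex.arg c
  have hcθ : (c : ℂ) = ‖(c : ℂ)‖ * Complex.exp (θ * Complex.I) :=
    (Complex.norm_mul_exp_arg_mul_I c).symm
  have hcn : (0 : ℝ) < ‖(c : ℂ)‖ := norm_pos_iff.2 c.ne_zero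
  -- If arg c were the rational multiple q of 2π, the power of c with exponent the denominator of q
  -- would be real.
  have hirr : Irrational (θ / (2 * Real.pi)) := by
    rintro ⟨q, hq⟩
    have hθ : θ = q * (2 * Real.pi) := by rw [hq]; field_simp
    apply hc q.den q.den_pos
    have : (c : ℂ) ^ q.den = ((‖(c : ℂ)‖ ^ q.den : ℝ) : ℂ) := by
      conv_lhs => rw [hcθ]
      rw [mul_pow, ← Complex.exp_nat_mul, hθ]
      have : ((q.den : ℕ) : ℂ) * (((q * (2 * Real.pi) : ℝ) : ℂ) * Complex.I) =
          (q.num : ℂ) * (2 * Real.pi * Complex.I) := by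
        have hq' : (q.den : ℂ) * (q : ℂ) = q.num := by exact_mod_cast Rat.den_mul_eq_num q
        push_cast
        rw [← hq']; ring
      rw [this, Complex.exp_int_mul_two_pi_mul_I]
      push_cast; ring
    rw [this, Complex.ofReal_im]
  have hdense : Dense (AddSubgroup.closure {θ, 2 * Real.pi} : Set ℝ) :=
    dense_addSubgroupClosure_pair_iff.2 hirr
  have key : ∀ x : ℝ, Complex.exp (x * Complex.I) * w₀ ∈ S := by
    have hcl : IsClosed {x : ℝ | Complex.exp (x * Complex.I) * w₀ ∈ S} :=
      hS.preimage (by fun_prop)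
    refine fun x => hcl.closure_subset_iff.2 ?_ (hdense x)
    intro x hx
    obtain ⟨k, n, rfl⟩ := AddSubgroup.mem_closure_pair.1 hx
    have h1 := hscale (‖(c : ℂ)‖ ^ (-k)) (by positivity) _ (hrot k w₀ hw₀)
    rw [mem_ofPred_eq]
    convert h1 using 1
    rw [← mul_assoc]
    congr 1
    generalize ‖(c : ℂ)‖ = ρ at hcθ hcn
    rw [hcθ, mul_zpow, ← Complex.exp_int_mul]
    have : ((k • θ + n • (2 * Real.pi) : ℝ) : ℂ) * Complex.I =
        k * (θ * Complex.I) + n * (2 * Real.pi * Complex.I) := by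
      simp only [zsmul_eq_mul]; push_cast; ring
    rw [this, Complex.exp_add, Complex.exp_int_mul_two_pi_mul_I, mul_one, ← mul_assoc]
    push_cast
    rw [← mul_assoc, ← zpow_add₀ (by exact_mod_cast hcn.ne')]
    simp
  refine eq_univ_of_forall fun w => ?_
  by_cases hw : w = 0
  · simpa [hw] using hscale 0 le_rfl w₀ hw₀
  have h1 := hscale (‖w / w₀‖) (norm_nonneg _) _ (key (Complex.arg (w / w₀)))
  rw [← mul_assoc, Complex.norm_mul_exp_arg_mul_I, div_mul_cancel₀ _ h0] at h1
  exact h1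

/-! ### Half lines in compact groups -/

section Compact

variable {T : Type*} [AddCommGroup T] [TopologicalSpace T] [IsTopologicalAddGroup T]
  [CompactSpace T] {φ : ℂ →+ T}

/-- By compactness finitely many z serve all base points y, and r bounds their norms. -/
lemma exists_radius_of_denseRange (hd : DenseRange φ) {W : Set T}
    (hW : IsOpen W) (hne : W.Nonempty) : ∃ r : ℝ, 0 < r ∧ ∀ y : T, ∃ z : ℂ, ‖z‖ ≤ r ∧ y + φ z ∈ W := by
  have hopen (z : ℂ) : IsOpen {y : T | y + φ z ∈ W} := hW.preimage (by fun_prop)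
  obtain ⟨t, ht⟩ := (isCompact_univ (X := T)).elim_finite_subcover _ hopen (by
    intro y _
    obtain ⟨z, hz⟩ := hd.exists_mem_open (hW.preimage (f := fun x => y + x) (by fun_prop))
      ⟨hne.some - y, by simpa using hne.some_mem⟩
    exact mem_iUnion.2 ⟨z, hz⟩)
  refine ⟨∑ z ∈ t, ‖z‖ + 1, by positivity, fun y => ?_⟩
  obtain ⟨z, hz, hy⟩ := mem_iUnion₂.1 (ht (mem_univ y))
  exact ⟨z, (Finset.single_le_sum (f := fun z : ℂ => ‖z‖) (fun _ _ => norm_nonneg _) hz).trans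
    (by linarith), hy⟩

/-- There is a direction in which all the half lines meet a given open set. -/
lemma exists_direction (hφ : Continuous φ) (hd : DenseRange φ) {V : Set T} (hV : IsOpen V)
    (hne : V.Nonempty) : ∃ d : ℂ, ∀ y : T, ∃ t : ℝ, 0 ≤ t ∧ y + φ (t * d) ∈ V := by
  obtain ⟨p, hp⟩ := hne
  have hV0 : (fun x => p + x) ⁻¹' V ∈ 𝓝 (0 : T) :=
    (hV.preimage (by fun_prop)).mem_nhds (by simpa using hp)
  obtain ⟨V₀, hV₀o, hV₀0, hV₀⟩ := exists_open_nhds_zero_add_subset hV0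
  have hO (x : T) : IsOpen {d : ℂ | ∃ t : ℝ, 0 ≤ t ∧ x + φ (t * d) - p ∈ V₀} := by
    have : {d : ℂ | ∃ t : ℝ, 0 ≤ t ∧ x + φ (t * d) - p ∈ V₀} =
        ⋃ t : {t : ℝ // 0 ≤ t}, {d : ℂ | x + φ (t.1 * d) - p ∈ V₀} := by
      ext d; simp
    rw [this]
    exact isOpen_iUnion fun t => hV₀o.preimage (by fun_prop)
  have hD (x : T) : Dense {d : ℂ | ∃ t : ℝ, 0 ≤ t ∧ x + φ (t * d) - p ∈ V₀} := by
    obtain ⟨r, hr, hr'⟩ := exists_radius_of_denseRange hd (W := (fun y => x + y - p) ⁻¹' V₀)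
      (hV₀o.preimage (by fun_prop)) ⟨p - x, by simpa using hV₀0⟩
    refine Metric.dense_iff.2 fun d₀ ρ hρ => ?_
    -- At time t = 2r/ρ, changing the direction by z/t, of norm at most ρ/2, moves the end point by
    -- z, and some ‖z‖ ≤ r reaches the target.
    have ht : 0 < 2 * r / ρ := by positivity
    obtain ⟨z, hz, hz'⟩ := hr' (φ ((2 * r / ρ : ℝ) * d₀))
    refine ⟨d₀ + z / (2 * r / ρ : ℝ), ?_, 2 * r / ρ, ht.le, ?_⟩
    · rw [Metric.mem_ball, dist_eq_norm, add_sub_cancel_left, norm_div, Complex.norm_real,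
        Real.norm_of_nonneg ht.le, div_lt_iff₀ ht]
      have : ρ * (2 * r / ρ) = 2 * r := by field_simp
      linarith
    · rw [mul_add, mul_div_cancel₀ _ (by exact_mod_cast ht.ne'), map_add]
      exact hz'
  have hcov : ∀ x : T, IsOpen ((fun y => y - x) ⁻¹' V₀) := fun x => hV₀o.preimage (by fun_prop)
  obtain ⟨s, hs⟩ := (isCompact_univ (X := T)).elim_finite_subcover _ hcov fun y _ =>
    mem_iUnion.2 ⟨y, by simpa using hV₀0⟩
  -- Good directions for one base point form an open dense set, so one d serves finitely many base
  -- points. The sum V₀ + V₀ absorbs the passage from y to a nearby one of them.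
  obtain ⟨d, hd⟩ := (dense_biInter_of_isOpen (S := (s : Set T)) (fun x _ => hO x)
    s.countable_toSet (fun x _ => hD x)).nonempty
  refine ⟨d, fun y => ?_⟩
  obtain ⟨x, hx, hy⟩ := mem_iUnion₂.1 (hs (mem_univ y))
  obtain ⟨t, ht, ht'⟩ := mem_iInter₂.1 hd x hx
  refine ⟨t, ht, ?_⟩
  have := hV₀ (add_mem_add hy ht')
  rwa [mem_preimage, show p + (y - x + (x + φ (t * d) - p)) = y + φ (t * d) by abel] at this

/-- If a closed set contains `φ (g z₀)` for a sequence of `g` growing to infinity and is invariant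
under multiplication by numbers arbitrarily close to `1`, it contains a half line. -/
lemma exists_halfLine (hφ : Continuous φ) {D : Set T} (hD : IsClosed D) {z₀ : ℂ} (hz₀ : z₀ ≠ 0)
    {G : Subgroup ℂˣ} (hG : ∀ g ∈ G, φ (g * z₀) ∈ D) {a : ℂˣ} (ha : a ∈ G) (ha1 : 1 < ‖(a : ℂ)‖)
    (hnear : ∀ ε : ℝ, 0 < ε → ∃ g ∈ G, g ≠ 1 ∧ ‖(g : ℂ) - 1‖ < ε) :
    ∃ w : ℂ, w ≠ 0 ∧ ∃ y : T, ∀ t : ℝ, 0 ≤ t → y + φ (t * w) ∈ D := by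
  have ha0 : 0 < ‖(a : ℂ)‖ := by linarith
  -- The exponent 2n makes the step e n from a^n z₀ to a^n g_n z₀ tend to 0 although a^n z₀ grows.
  choose g hgG hg1 hg using fun n : ℕ => hnear ((‖(a : ℂ)‖⁻¹) ^ (2 * n)) (by positivity)
  set δ : ℕ → ℂ := fun n => (g n : ℂ) - 1 with hδ
  have hδ0 n : δ n ≠ 0 := fun h => hg1 n (Units.ext (sub_eq_zero.1 h))
  set e : ℕ → ℂ := fun n => a ^ n * z₀ * δ n with he
  have he0 n : e n ≠ 0 := mul_ne_zero (mul_ne_zero (pow_ne_zero _ a.ne_zero) hz₀) (hδ0 n)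
  have hinv : ‖(a : ℂ)‖⁻¹ < 1 := inv_lt_one_of_one_lt₀ ha1
  have hpow : Tendsto (fun n : ℕ => ‖(a : ℂ)‖⁻¹ ^ n) atTop (𝓝 0) :=
    tendsto_pow_atTop_nhds_zero_of_lt_one (by positivity) hinv
  have helim : Tendsto (fun n => ‖e n‖) atTop (𝓝 0) := by
    have hb : Tendsto (fun n : ℕ => ‖(a : ℂ)‖⁻¹ ^ n * ‖z₀‖) atTop (𝓝 0) := by
      simpa only [zero_mul] using hpow.mul_const ‖z₀‖
    refine squeeze_zero (fun _ => norm_nonneg _) (fun n => ?_) hb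
    simp only [he, norm_mul, norm_pow]
    calc ‖(a : ℂ)‖ ^ n * ‖z₀‖ * ‖δ n‖ ≤ ‖(a : ℂ)‖ ^ n * ‖z₀‖ * ‖(a : ℂ)‖⁻¹ ^ (2 * n) := by
          gcongr; exact (hg n).le
      _ = ‖(a : ℂ)‖⁻¹ ^ n * ‖z₀‖ := by
          rw [inv_pow, inv_pow, mul_comm 2 n, pow_mul]; field_simp
  have hratio : Tendsto (fun n => ‖δ n‖ / ‖e n‖) atTop (𝓝 0) := by
    have : (fun n => ‖δ n‖ / ‖e n‖) = fun n => ‖(a : ℂ)‖⁻¹ ^ n * ‖z₀‖⁻¹ := by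
      funext n
      have := norm_pos_iff.2 (hδ0 n)
      have := norm_pos_iff.2 hz₀
      simp only [he, norm_mul, norm_pow, inv_pow]
      field_simp
    rw [this]; simpa using hpow.mul_const ‖z₀‖⁻¹
  -- One ultrafilter yields the limit direction w and the limit base point y together, independently
  -- of t, without sequential compactness of T.
  let U : Ultrafilter ℕ := hyperfilter ℕ
  have hU : (U : Filter ℕ) ≤ atTop := by
    rw [← Nat.cofinite_eq_atTop]; exact hyperfilter_le_cofinite
  obtain ⟨w, hw1, hw⟩ := (isCompact_sphere (0 : ℂ) 1).ultrafilter_le_nhds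
    (U.map fun n => e n / ‖e n‖) (by
      refine le_principal_iff.2 (Ultrafilter.mem_map.2 (Filter.univ_mem' fun n => ?_))
      have := norm_pos_iff.2 (he0 n)
      simp [this.ne'])
  obtain ⟨y, -, hy⟩ := (isCompact_univ (X := T)).ultrafilter_le_nhds
    (U.map fun n => φ (a ^ n * z₀)) (by simp)
  replace hw : Tendsto (fun n => e n / ‖e n‖) U (𝓝 w) := hw
  replace hy : Tendsto (fun n => φ (a ^ n * z₀)) U (𝓝 y) := hy
  refine ⟨w, by rintro rfl; simp at hw1, y, fun t ht => ?_⟩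
  -- The points a^n z₀ g_n^J progress by nearly e n at each step, so about t/‖e n‖ steps cover
  -- length t. The deviation from a straight line is quadratic in J‖δ n‖ and vanishes in the limit.
  set J : ℕ → ℕ := fun n => ⌊t / ‖e n‖⌋₊ with hJ
  have hJle n : (J n : ℝ) ≤ t / ‖e n‖ := Nat.floor_le (by positivity)
  have hJlim : Tendsto (fun n => J n * ‖e n‖) atTop (𝓝 t) := by
    have h1 : Tendsto (fun n => t - ‖e n‖) atTop (𝓝 t) := by simpa using helim.const_sub t
    refine tendsto_of_tendsto_of_tendsto_of_le_of_le h1 tendsto_const_nhds (fun n => ?_) fun n => ?_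
    · have h2 : t / ‖e n‖ < J n + 1 := Nat.lt_floor_add_one _
      have h3 := norm_pos_iff.2 (he0 n)
      rw [div_lt_iff₀ h3] at h2
      simp only
      linarith
    · have h3 := norm_pos_iff.2 (he0 n)
      exact (le_div_iff₀ h3).1 (hJle n)
  have hJδ : ∀ n, J n * ‖δ n‖ ≤ t * (‖δ n‖ / ‖e n‖) := fun n => by
    calc J n * ‖δ n‖ ≤ t / ‖e n‖ * ‖δ n‖ := by gcongr; exact hJle n
      _ = _ := by ring
  have hJδ0 : Tendsto (fun n => J n * ‖δ n‖) atTop (𝓝 0) :=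
    squeeze_zero (fun _ => by positivity) hJδ (by simpa using hratio.const_mul t)
  have herr : Tendsto (fun n => a ^ n * z₀ * ((1 + δ n) ^ J n - 1 - J n * δ n)) atTop (𝓝 0) := by
    rw [tendsto_zero_iff_norm_tendsto_zero]
    have hb : Tendsto (fun n => t * (J n * ‖δ n‖)) atTop (𝓝 0) := by simpa using hJδ0.const_mul t
    refine squeeze_zero' (Eventually.of_forall fun _ => norm_nonneg _) ?_ hb
    filter_upwards [hJδ0.eventually_lt_const one_pos] with n hn
    rw [norm_mul]
    calc _ ≤ ‖(a : ℂ) ^ n * z₀‖ * (J n * ‖δ n‖) ^ 2 := by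
          gcongr; exact norm_one_add_pow_sub_le_sq _ _ hn.le
      _ = (J n * ‖e n‖) * (J n * ‖δ n‖) := by simp only [he, norm_mul]; ring
      _ ≤ _ := by
          gcongr
          have h3 := norm_pos_iff.2 (he0 n)
          exact (le_div_iff₀ h3).1 (hJle n)
  have hmain : Tendsto (fun n => φ (a ^ n * z₀) + φ (((J n * ‖e n‖ : ℝ) : ℂ) * (e n / ‖e n‖) +
      a ^ n * z₀ * ((1 + δ n) ^ J n - 1 - J n * δ n))) U (𝓝 (y + φ (t * w))) := by
    refine hy.add ((hφ.tendsto _).comp ?_)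
    have h1 : Tendsto (fun n => ((J n * ‖e n‖ : ℝ) : ℂ)) U (𝓝 (t : ℂ)) :=
      (Complex.continuous_ofReal.tendsto _).comp (hJlim.mono_left hU)
    simpa using (h1.mul hw).add (herr.mono_left hU)
  refine hD.mem_of_tendsto hmain (Eventually.of_forall fun n => ?_)
  have h1 := hG (a ^ n * (g n) ^ J n) (mul_mem (pow_mem ha n) (pow_mem (hgG n) _))
  rw [← map_add]
  convert h1 using 2
  have h3 : (‖e n‖ : ℂ) ≠ 0 := by exact_mod_cast (norm_pos_iff.2 (he0 n)).ne'
  have h4 : (g n : ℂ) = 1 + δ n := by simp [hδ]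
  push_cast
  rw [h4, mul_assoc (J n : ℂ), mul_div_cancel₀ _ h3]
  simp only [he]
  ring

end Compact

/-! ### Uniform contraction in topological rings -/

section Contraction

variable {E : Type*} [CommRing E] [TopologicalSpace E] [IsTopologicalRing E]

lemma eventually_forall_mul_mem {f : ℕ → E} (hf : Tendsto f atTop (𝓝 0)) {C : Set E}
    (hC : IsCompact C) {W : Set E} (hW : W ∈ 𝓝 (0 : E)) :
    ∀ᶠ k in atTop, ∀ x ∈ C, f k * x ∈ W := by
  refine hf.eventually (p := fun a => ∀ x ∈ C, a * x ∈ W)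
    (hC.eventually_forall_of_forall_eventually fun x _ => ?_)
  have : Tendsto (fun z : E × E => z.1 * z.2) (𝓝 (0, x)) (𝓝 (0 * x)) :=
    (continuous_fst.mul continuous_snd).tendsto _
  rw [zero_mul] at this
  exact this hW

/-- A convergent sequence together with its limit is compact, so multiplications by its terms are
equicontinuous at 0. -/
lemma exists_nhds_forall_mul_mem {f : ℕ → E} (hf : Tendsto f atTop (𝓝 0)) {W : Set E}
    (hW : W ∈ 𝓝 (0 : E)) : ∃ V ∈ 𝓝 (0 : E), ∀ k, ∀ x ∈ V, f k * x ∈ W := by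
  have h := hf.isCompact_insert_range.eventually_forall_of_forall_eventually (x₀ := (0 : E))
    (P := fun x y => y * x ∈ W) fun y _ => by
      have : Tendsto (fun z : E × E => z.2 * z.1) (𝓝 (0, y)) (𝓝 (y * 0)) :=
        (continuous_snd.mul continuous_fst).tendsto _
      rw [mul_zero] at this
      exact this hW
  exact ⟨_, h, fun k x hx => hx _ (mem_insert_of_mem _ (mem_range_self k))⟩

end Contraction

/-! ### Minimal invariant sets and rich groups of units -/

lemma exists_minimal_invariant {G X : Type*} [SMul G X] [TopologicalSpace X] [CompactSpace X]
    {N : Set X} (hN : IsClosed N) (hne : N.Nonempty) (hinv : ∀ g : G, ∀ x ∈ N, g • x ∈ N) :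
    ∃ M ⊆ N, M.Nonempty ∧ IsClosed M ∧ (∀ g : G, ∀ x ∈ M, g • x ∈ M) ∧
      ∀ M' ⊆ M, M'.Nonempty → IsClosed M' → (∀ g : G, ∀ x ∈ M', g • x ∈ M') → M' = M := by
  obtain ⟨M, hMN, hM⟩ := zorn_superset_nonempty
    {M : Set X | M.Nonempty ∧ IsClosed M ∧ ∀ g : G, ∀ x ∈ M, g • x ∈ M} (by
      intro c hc hchain hcne
      have : Nonempty c := hcne.to_subtype
      refine ⟨⋂₀ c, ⟨?_, isClosed_sInter fun s hs => (hc hs).2.1, fun g x hx s hs =>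
        (hc hs).2.2 g x (hx s hs)⟩, fun s hs => sInter_subset_of_mem hs⟩
      exact IsCompact.nonempty_sInter_of_directed_nonempty_isCompact_isClosed
        (fun a ha b hb => (hchain.total ha hb).elim (fun hab => ⟨a, ha, subset_rfl, hab⟩)
          fun hba => ⟨b, hb, hba, subset_rfl⟩) (fun s hs => (hc hs).1)
        (fun s hs => (hc hs).2.1.isCompact) fun s hs => (hc hs).2.1) N ⟨hne, hN, hinv⟩
  exact ⟨M, hMN, hM.prop.1, hM.prop.2.1, hM.prop.2.2, fun M' h1 h2 h3 h4 =>
    h1.antisymm (hM.le_of_le ⟨h2, h3, h4⟩ h1)⟩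

/-- A topological `R`-algebra `E` with several factors `ℂ`, given by projections `p v` and
inclusions `j v`, and a group `Γ` of units of `R` that is rich enough to expand each of the complex
factors while contracting the complementary factor, to contract the complement of all the complex
factors, to have rank at least two, and to rotate each of the complex factors irrationally. -/
structure IsExpanding {R E ι : Type*} [CommRing R] [CommRing E] [TopologicalSpace E] [Algebra R E]
    [Fintype ι] (p : ι → E →+* ℂ) (j : ι → ℂ →+ E) (Γ : Subgroup Rˣ) : Prop where
  continuous_p (v : ι) : Continuous (p v)
  continuous_j (v : ι) : Continuous (j v)
  mul_j (v : ι) (x : E) (z : ℂ) : x * j v z = j v (p v x * z)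
  expand (v : ι) : ∃ u ∈ Γ, 1 < ‖p v (algebraMap R E u)‖ ∧
    Tendsto (fun k : ℕ => algebraMap R E u ^ k * (1 - j v 1)) atTop (𝓝 0)
  contract : ∃ u ∈ Γ, Tendsto (fun k : ℕ => algebraMap R E u ^ k * (1 - ∑ v, j v 1)) atTop (𝓝 0)
  rank (v : ι) : ∃ a ∈ Γ, ∃ b ∈ Γ, 1 < ‖p v (algebraMap R E a)‖ ∧
    ∀ m k : ℤ, p v (algebraMap R E (a ^ m * b ^ k : Rˣ)) = 1 → k = 0
  rotate (v : ι) : ∃ c ∈ Γ, ∀ m : ℕ, 0 < m → (p v (algebraMap R E c) ^ m).im ≠ 0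

/-! ### Difference sets of minimal sets and torsion points -/

section Dynamics

variable {R E T ι : Type*} [CommRing R] [CommRing E] [TopologicalSpace E] [IsTopologicalRing E]
  [Algebra R E] [AddCommGroup T] [Module R T] [TopologicalSpace T] [IsTopologicalAddGroup T]
  [CompactSpace T] [T2Space T] [Fintype ι]
  {p : ι → E →+* ℂ} {j : ι → ℂ →+ E} {Γ : Subgroup Rˣ} {π : E →ₗ[R] T}

namespace IsExpanding

omit [IsTopologicalRing E] in
lemma map_powMonoidHom (h : IsExpanding p j Γ) {m : ℕ} (hm : 0 < m) :
    IsExpanding p j (Γ.map (powMonoidHom m)) where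
  continuous_p := h.continuous_p
  continuous_j := h.continuous_j
  mul_j := h.mul_j
  expand v := by
    obtain ⟨u, hu, h1, h2⟩ := h.expand v
    refine ⟨u ^ m, ⟨u, hu, rfl⟩, ?_, ?_⟩
    · simpa using one_lt_pow₀ h1 hm.ne'
    · simpa [Function.comp_def, pow_mul] using
        h2.comp (tendsto_id.const_mul_atTop' hm)
  contract := by
    obtain ⟨u, hu, h2⟩ := h.contract
    refine ⟨u ^ m, ⟨u, hu, rfl⟩, ?_⟩
    simpa [Function.comp_def, pow_mul] using h2.comp (tendsto_id.const_mul_atTop' hm)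
  rank v := by
    obtain ⟨a, ha, b, hb, h1, h2⟩ := h.rank v
    refine ⟨a ^ m, ⟨a, ha, rfl⟩, b ^ m, ⟨b, hb, rfl⟩, by simpa using one_lt_pow₀ h1 hm.ne',
      fun i k hik => ?_⟩
    have := h2 (m * i) (m * k) (by simpa only [zpow_mul, zpow_natCast] using hik)
    simpa [hm.ne'] using this
  rotate v := by
    obtain ⟨c, hc, h1⟩ := h.rotate v
    refine ⟨c ^ m, ⟨c, hc, rfl⟩, fun k hk => ?_⟩
    simpa [← pow_mul] using h1 (m * k) (by positivity)

omit [TopologicalSpace E] [IsTopologicalRing E] [TopologicalSpace T] [IsTopologicalAddGroup T]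
  [CompactSpace T] [T2Space T] in
lemma smul_map (u : R) (x : E) : u • π x = π (algebraMap R E u * x) := by
  rw [← map_smul, Algebra.smul_def]

/-- An infinite invariant set has arbitrarily close points whose difference has a nonzero complex
component. -/
lemma exists_mem_nhds (h : IsExpanding p j Γ) [LocallyCompactSpace E] (hπ : Continuous π)
    (hπo : IsOpenMap π) {M : Set T} (hM : ∀ ε ∈ Γ, ∀ x ∈ M, ε • x ∈ M) (hinf : M.Infinite)
    {U : Set E} (hU : U ∈ 𝓝 (0 : E)) :
    ∃ x ∈ U, (∃ a ∈ M, ∃ b ∈ M, π x = a - b) ∧ ∃ v, p v x ≠ 0 := by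
  classical
  by_contra! hcon
  obtain ⟨ϖ, hϖ, hlim⟩ := h.contract
  obtain ⟨C, hC, hCU, hCc⟩ := local_compact_nhds hU
  obtain ⟨V, hV, hVsub⟩ := exists_nhds_half_neg (s := π '' C)
    (by simpa using hπo.image_mem_nhds hC)
  obtain ⟨t, -, ht⟩ := (isCompact_univ (X := T)).elim_nhds_subcover (fun x => {y | y - x ∈ V})
    fun x _ => ((continuous_id.sub continuous_const).tendsto' x 0 (sub_self x)) hV
  -- One point more than the cover has members: two of them become close after applying any (ϖ^k)⁻¹.
  -- The exponent k is chosen afterwards, so large that ϖ^k brings this difference into W.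
  obtain ⟨s, hsM, hs⟩ := hinf.exists_subset_card_eq (t.card + 1)
  obtain ⟨W, hW, hWs⟩ : ∃ W ∈ 𝓝 (0 : T), ∀ a ∈ s, ∀ b ∈ s, a ≠ b → a - b ∉ W := by
    refine ⟨⋂ a ∈ s, ⋂ b ∈ s, {y | a ≠ b → a - b ≠ y}, ?_, fun a ha b hb hab hmem => ?_⟩
    · refine (Filter.biInter_finset_mem _).2 fun a _ => (Filter.biInter_finset_mem _).2 fun b _ => ?_
      by_cases hab : a = b
      · simp [hab]
      · filter_upwards [isOpen_compl_singleton.mem_nhds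
          (show (0 : T) ∈ ({a - b} : Set T)ᶜ from fun h0 => hab (sub_eq_zero.1 h0.symm))] with y hy
        exact fun _ h0 => hy h0.symm
    · simp only [mem_iInter] at hmem
      exact hmem a ha b hb hab rfl
  obtain ⟨k, hk⟩ := (eventually_forall_mul_mem hlim hCc
    (hπ.continuousAt.preimage_mem_nhds (by simpa using hW))).exists
  have hcov (y : T) : ∃ x ∈ t, (ϖ ^ k)⁻¹ • y - x ∈ V := by
    simpa using ht (mem_univ ((ϖ ^ k)⁻¹ • y))
  choose f hft hf using hcov
  obtain ⟨a, ha, b, hb, hab, hfab⟩ := Finset.exists_ne_map_eq_of_card_lt_of_maps_to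
    (by omega : t.card < s.card) (f := f) fun y _ => hft y
  have h1 := hVsub _ (hf a) _ (hf b)
  rw [hfab, sub_sub_sub_cancel_right] at h1
  obtain ⟨x, hxC, hx⟩ := h1
  have hMk : ∀ y ∈ M, (ϖ ^ k)⁻¹ • y ∈ M := hM _ (inv_mem (pow_mem hϖ k))
  have hx0 := hcon x (hCU hxC) ⟨_, hMk a (hsM ha), _, hMk b (hsM hb), hx⟩
  -- With all complex components zero, x lies in the complement that ϖ contracts, so ϖ^k sends its
  -- image a - b into W, which excludes such differences.
  have hxe : (1 - ∑ v, j v 1) * x = x := by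
    rw [sub_mul, one_mul, Finset.sum_mul, Finset.sum_eq_zero, sub_zero]
    intro v _
    rw [mul_comm, h.mul_j, hx0, zero_mul, map_zero]
  refine hWs a ha b hb hab ?_
  have h2 := hk x hxC
  rw [mul_assoc, hxe, mem_preimage, ← map_pow, ← Units.val_pow_eq_pow_val, ← smul_map, hx,
    ← smul_sub] at h2
  rwa [← Units.smul_def, smul_inv_smul] at h2

omit [IsTopologicalAddGroup T] [CompactSpace T] [T2Space T] in
/-- Expanding small elements with nonzero complex component gives elements that lie in one of the
complex factors. -/
lemma exists_map_j_mem (h : IsExpanding p j Γ) (hπ : Continuous π) {D : Set T} (hD : IsClosed D)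
    (hDinv : ∀ ε ∈ Γ, ∀ x ∈ D, ε • x ∈ D)
    (hsmall : ∀ U ∈ 𝓝 (0 : E), ∃ x ∈ U, π x ∈ D ∧ ∃ v, p v x ≠ 0) :
    ∃ v, ∃ z : ℂ, z ≠ 0 ∧ π (j v z) ∈ D := by
  obtain ⟨v, hv⟩ : ∃ v, ∀ U ∈ 𝓝 (0 : E), ∃ x ∈ U, π x ∈ D ∧ p v x ≠ 0 := by
    by_contra! hcon
    choose U hU hU' using hcon
    obtain ⟨x, hx, hxD, v, hxv⟩ := hsmall (⋂ v, U v) (Filter.iInter_mem.2 hU)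
    exact hxv (hU' v x (mem_iInter.1 hx v) hxD)
  obtain ⟨u, hu, hu1, hlim⟩ := h.expand v
  set ρ := ‖p v (algebraMap R E u)‖ with hρ
  have hstep : ∀ U ∈ 𝓝 (0 : E), ∃ z : ℂ, 1 ≤ ‖z‖ ∧ ‖z‖ ≤ ρ ∧ ∃ y ∈ U, π (j v z + y) ∈ D := by
    intro U hU
    obtain ⟨V, hV, hVU⟩ := exists_nhds_forall_mul_mem hlim hU
    have hball : {x : E | ‖p v x‖ < 1} ∈ 𝓝 (0 : E) :=
      (isOpen_lt ((h.continuous_p v).norm) continuous_const).mem_nhds (by simp)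
    obtain ⟨x, ⟨hxV, hx1⟩, hxD, hx0⟩ := hv _ (inter_mem hV hball)
    -- Here ρ^(-(k+1)) < ‖p v x‖ ≤ ρ^(-k), so u^(k+1) carries the v-component into the annulus
    -- between 1 and ρ, while the other components stay small.
    obtain ⟨k, hk1, hk2⟩ := exists_nat_pow_near_of_lt_one
      (x := ‖p v x‖) (y := ρ⁻¹) (norm_pos_iff.2 hx0) (le_of_lt hx1) (by positivity)
      (inv_lt_one_of_one_lt₀ hu1)
    have hρ0 : 0 < ρ := by linarith
    rw [inv_pow, inv_lt_iff_one_lt_mul₀ (by positivity)] at hk1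
    rw [inv_pow, le_inv_comm₀ (norm_pos_iff.2 hx0) (by positivity), ← one_div,
      le_div_iff₀ (norm_pos_iff.2 hx0)] at hk2
    refine ⟨p v (algebraMap R E u ^ (k + 1) * x), ?_, ?_, algebraMap R E u ^ (k + 1) *
      (1 - j v 1) * x, hVU _ _ hxV, ?_⟩
    · rw [map_mul, map_pow, norm_mul, norm_pow]
      linarith
    · rw [map_mul, map_pow, norm_mul, norm_pow, ← hρ, pow_succ']
      nlinarith
    · have : j v (p v (algebraMap R E u ^ (k + 1) * x)) + algebraMap R E u ^ (k + 1) *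
          (1 - j v 1) * x = algebraMap R E u ^ (k + 1) * x := by
        rw [← mul_one (p v _), ← h.mul_j]; ring
      rw [this, ← map_pow, ← Units.val_pow_eq_pow_val, ← smul_map]
      exact hDinv _ (pow_mem hu _) _ hxD
  refine ⟨v, ?_⟩
  by_contra! hcon
  -- If the compact annulus missed the closed preimage of D, so would a neighbourhood of it, against
  -- `hstep`.
  have hcomp : IsCompact (j v '' {z : ℂ | 1 ≤ ‖z‖ ∧ ‖z‖ ≤ ρ}) := by
    refine IsCompact.image ?_ (h.continuous_j v)
    refine (isCompact_closedBall (0 : ℂ) ρ).of_isClosed_subset ?_ fun z hz => by simpa using hz.2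
    exact (isClosed_le continuous_const continuous_norm).inter
      (isClosed_le continuous_norm continuous_const)
  obtain ⟨U, hU, hUD⟩ := compact_open_separated_add_right hcomp
    ((hD.preimage hπ).isOpen_compl) (by
      rintro _ ⟨z, hz, rfl⟩
      exact hcon z (by rintro rfl; norm_num at hz))
  obtain ⟨z, hz1, hz2, y, hy, hzy⟩ := hstep U hU
  exact hUD (add_mem_add ⟨z, ⟨hz1, hz2⟩, rfl⟩ hy) hzy

omit [T2Space T] in
/-- Each of the complex factors has dense image in the compact quotient. -/
lemma denseRange_map_j (h : IsExpanding p j Γ) [LocallyCompactSpace E] (hπ : Continuous π)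
    (hπo : IsOpenMap π) (hπs : Function.Surjective π) (v : ι) :
    DenseRange (fun z => π (j v z)) := by
  obtain ⟨u, hu, -, hlim⟩ := h.expand v
  obtain ⟨C, hC, hC'⟩ : ∃ C : Set E, IsCompact C ∧ ∀ y : T, ∃ x ∈ C, π x = y := by
    choose C hC using fun x : E => exists_compact_mem_nhds x
    obtain ⟨t, -, ht⟩ := (isCompact_univ (X := T)).elim_nhds_subcover
      (fun y => π '' C (hπs y).choose) fun y _ => by
        have := hπo.image_mem_nhds (hC (hπs y).choose).2
        rwa [(hπs y).choose_spec] at this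
    refine ⟨⋃ y ∈ t, C (hπs y).choose, t.isCompact_biUnion fun y _ => (hC _).1, fun y => ?_⟩
    obtain ⟨i, hi, x, hx, rfl⟩ := mem_iUnion₂.1 (ht (mem_univ y))
    exact ⟨x, mem_iUnion₂.2 ⟨i, hi, hx⟩, rfl⟩
  intro y
  refine mem_closure_iff_nhds.2 fun W hW => ?_
  have hW' : (fun x => y - x) ⁻¹' W ∈ 𝓝 (0 : T) :=
    (continuous_const.sub continuous_id).continuousAt.preimage_mem_nhds (by simpa using hW)
  obtain ⟨k, hk⟩ := (eventually_forall_mul_mem hlim hC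
    (hπ.continuousAt.preimage_mem_nhds (by simpa using hW'))).exists
  -- Every y is u^k times the image of a point of C, and u^k contracts everything outside the factor
  -- v uniformly on C.
  obtain ⟨x, hxC, hx⟩ := hC' ((u ^ k)⁻¹ • y)
  have hy : y = π (algebraMap R E u ^ k * x) := by
    rw [← map_pow, ← Units.val_pow_eq_pow_val, ← smul_map, hx, ← Units.smul_def, smul_inv_smul]
  refine ⟨π (j v (p v (algebraMap R E u ^ k * x))), ?_, mem_range_self _⟩
  have h1 := hk x hxC
  have h2 : algebraMap R E u ^ k * (1 - j v 1) * x =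
      algebraMap R E u ^ k * x - j v (p v (algebraMap R E u ^ k * x)) := by
    rw [← mul_one (p v _), ← h.mul_j]; ring
  rw [h2] at h1
  simpa [hy] using h1

omit [T2Space T] in
/-- A closed invariant set that contains arbitrarily small elements with a nonzero complex component
is everything. -/
lemma eq_univ (h : IsExpanding p j Γ) [LocallyCompactSpace E] [ContinuousConstSMul R T]
    (hπ : Continuous π) (hπo : IsOpenMap π) (hπs : Function.Surjective π) {D : Set T}
    (hD : IsClosed D) (hDinv : ∀ ε ∈ Γ, ∀ x ∈ D, ε • x ∈ D)
    (hsmall : ∀ U ∈ 𝓝 (0 : E), ∃ x ∈ U, π x ∈ D ∧ ∃ v, p v x ≠ 0) : D = univ := by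
  obtain ⟨v, z₀, hz₀, hz₀D⟩ := h.exists_map_j_mem hπ hD hDinv hsmall
  let φ : ℂ →+ T := (π : E →+ T).comp (j v)
  have hφ : Continuous φ := hπ.comp (h.continuous_j v)
  have hdense : DenseRange φ := h.denseRange_map_j hπ hπo hπs v
  have hsmul (u : Rˣ) (z : ℂ) : u • φ z = φ (p v (algebraMap R E u) * z) := by
    rw [Units.smul_def]
    change (u : R) • π (j v z) = π (j v _)
    rw [smul_map, h.mul_j]
  let σ : Rˣ →* ℂˣ := Units.map ((p v).comp (algebraMap R E) : R →* ℂ)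
  have hσ (u : Rˣ) : (σ u : ℂ) = p v (algebraMap R E u) := rfl
  obtain ⟨a, ha, b, hb, ha1, hab⟩ := h.rank v
  obtain ⟨c, hc, hrot⟩ := h.rotate v
  obtain ⟨w, hw0, y, hy⟩ := exists_halfLine hφ hD hz₀ (G := Γ.map σ) (by
      rintro _ ⟨g, hg, rfl⟩
      rw [hσ, ← hsmul]
      exact hDinv g hg _ hz₀D) ⟨a, ha, rfl⟩ ha1 fun ε hε =>
    exists_mem_near_one (G := Γ.map σ) (a := σ a) (b := σ b) ⟨a, ha, rfl⟩ ⟨b, hb, rfl⟩ ha1 (fun m k hmk => hab m k (by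
      rw [← hσ, map_mul, map_zpow, map_zpow, hmk, Units.val_one])) hε
  -- The directions of half lines in D, with base point free: since base points range over a compact
  -- space, S is closed.
  set S : Set ℂ := {w | ∃ y : T, ∀ t : ℝ, 0 ≤ t → y + φ (t * w) ∈ D} with hS
  have hSclosed : IsClosed S := by
    have hcl : IsClosed {q : T × ℂ | ∀ t : ℝ, 0 ≤ t → q.1 + φ (t * q.2) ∈ D} := by
      simp only [ofPred_forall]
      exact isClosed_iInter fun t => isClosed_iInter fun _ => hD.preimage (by fun_prop)
    convert isClosedMap_snd_of_compactSpace _ hcl using 1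
    ext w
    simp [hS]
  have hSu : S = univ := by
    refine eq_univ_of_rotation hSclosed (c := σ c) hrot ?_ ?_ ⟨y, hy⟩ hw0
    · rintro k w ⟨y, hy⟩
      refine ⟨(c ^ k) • y, fun t ht => ?_⟩
      have h1 := hDinv _ (zpow_mem hc k) _ (hy t ht)
      rw [smul_add, hsmul, ← hσ, map_zpow, Units.val_zpow_eq_zpow_val] at h1
      rwa [mul_left_comm]
    · rintro s hs w ⟨y, hy⟩
      refine ⟨y, fun t ht => ?_⟩
      rw [← mul_assoc, ← Complex.ofReal_mul]
      exact hy _ (by positivity)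
  rw [← hD.closure_eq]
  refine Dense.closure_eq fun x => mem_closure_iff.2 fun V hV hxV => ?_
  obtain ⟨d, hd⟩ := exists_direction hφ hdense hV ⟨x, hxV⟩
  obtain ⟨y, hy⟩ : d ∈ S := hSu ▸ mem_univ d
  obtain ⟨t, ht, ht'⟩ := hd y
  exact ⟨_, ht', hy t ht⟩

/-- A minimal invariant set is finite or invariant under translation by all elements fixed by the
group. -/
lemma add_mem_of_minimal (h : IsExpanding p j Γ) [LocallyCompactSpace E] [ContinuousConstSMul R T]
    (hπ : Continuous π) (hπo : IsOpenMap π) (hπs : Function.Surjective π) {M : Set T}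
    (hM : IsClosed M) (hinv : ∀ ε ∈ Γ, ∀ x ∈ M, ε • x ∈ M)
    (hmin : ∀ M' ⊆ M, M'.Nonempty → IsClosed M' → (∀ ε ∈ Γ, ∀ x ∈ M', ε • x ∈ M') → M' = M)
    (hinf : M.Infinite) {r : T} (hr : ∀ ε ∈ Γ, ε • r = r) {x : T} (hx : x ∈ M) : x + r ∈ M := by
  set D : Set T := (fun q : T × T => q.1 - q.2) '' (M ×ˢ M) with hDdef
  have hD : IsClosed D :=
    ((hM.isCompact.prod hM.isCompact).image (continuous_fst.sub continuous_snd)).isClosed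
  have hDu : D = univ := by
    refine h.eq_univ hπ hπo hπs hD ?_ fun U hU => ?_
    · rintro ε hε _ ⟨⟨a, b⟩, ⟨ha, hb⟩, rfl⟩
      exact ⟨(ε • a, ε • b), ⟨hinv ε hε a ha, hinv ε hε b hb⟩, (smul_sub ε a b).symm⟩
    · obtain ⟨x, hxU, ⟨a, ha, b, hb, hab⟩, hv⟩ := h.exists_mem_nhds hπ hπo hinv hinf hU
      exact ⟨x, hxU, ⟨(a, b), ⟨ha, hb⟩, hab.symm⟩, hv⟩
  -- As r = a - b, the point b lies in both M and M - r. Their intersection is invariant because r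
  -- is fixed, so it is M by minimality.
  obtain ⟨⟨a, b⟩, ⟨ha, hb⟩, hab⟩ : r ∈ D := hDu ▸ mem_univ r
  simp only at hab
  have hM' : M ∩ (fun y => y + r) ⁻¹' M = M := by
    refine hmin _ inter_subset_left ⟨b, hb, ?_⟩ (hM.inter (hM.preimage (by fun_prop))) ?_
    · rw [mem_preimage, ← hab, add_sub_cancel]; exact ha
    · rintro ε hε y ⟨hy, hy'⟩
      refine ⟨hinv ε hε y hy, ?_⟩
      have := hinv ε hε _ hy'
      rwa [smul_add, hr ε hε] at this
  exact (hM'.symm ▸ hx : x ∈ M ∩ (fun y => y + r) ⁻¹' M).2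

theorem exists_mem_torsion (h : IsExpanding p j (⊤ : Subgroup Rˣ)) [Nonempty ι]
    [LocallyCompactSpace E] [ContinuousConstSMul R T]
    (hπ : Continuous π) (hπo : IsOpenMap π) (hπs : Function.Surjective π)
    (hdvd : ∀ c : R, c ≠ 0 → ∃ d : R, ∃ n : ℕ, n ≠ 0 ∧ d * c = n)
    (hfin : ∀ n : ℕ, n ≠ 0 → {x : T | n • x = 0}.Finite)
    (hdense : Dense (AddCommGroup.torsion T : Set T))
    {N : Set T} (hN : IsClosed N) (hne : N.Nonempty) (hinv : ∀ ε : Rˣ, ∀ x ∈ N, ε • x ∈ N) :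
    ∃ x ∈ N, x ∈ AddCommGroup.torsion T := by
  by_contra! hcon
  have hstep : ∀ n : ℕ, n ≠ 0 → ∃ x ∈ N, ∀ r : T, n • r = 0 → x + r ∈ N := by
    intro n hn
    obtain ⟨m, hm, hm'⟩ : ∃ m : ℕ, 0 < m ∧ ∀ ε : Rˣ, ∀ r : T, n • r = 0 → ε ^ m • r = r := by
      have : Finite {x : T // n • x = 0} := hfin n hn
      -- Units permute the finite n-torsion, so raising to the order of its permutation group makes
      -- them act trivially there.
      refine ⟨Nat.card (Equiv.Perm {x : T // n • x = 0}), Nat.card_pos, fun ε r hr => ?_⟩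
      have hpres (ε : Rˣ) (x : T) (hx : n • x = 0) : n • (ε • x) = 0 := by
        rw [smul_comm, hx, smul_zero]
      let e : Rˣ →* Equiv.Perm {x : T // n • x = 0} :=
        { toFun := fun ε =>
            { toFun := fun x => ⟨ε • x.1, hpres ε _ x.2⟩
              invFun := fun x => ⟨ε⁻¹ • x.1, hpres ε⁻¹ _ x.2⟩
              left_inv := fun x => by simp
              right_inv := fun x => by simp }
          map_one' := by ext x; simp
          map_mul' := fun a b => by ext x; simp [mul_smul] }
      have h1 : e (ε ^ Nat.card (Equiv.Perm {x : T // n • x = 0})) = 1 := by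
        rw [map_pow, pow_card_eq_one']
      exact congrArg Subtype.val (DFunLike.congr_fun h1 ⟨r, hr⟩)
    set Γ : Subgroup Rˣ := (⊤ : Subgroup Rˣ).map (powMonoidHom m)
    have hΓ : IsExpanding p j Γ := h.map_powMonoidHom hm
    obtain ⟨M, hMN, ⟨x, hx⟩, hM, hMinv, hmin⟩ := exists_minimal_invariant (G := Γ) hN hne
      fun g => hinv g
    -- In a finite M two powers of an expanding u agree on x, so the nonzero u^l - u^k kills x. It
    -- divides a nonzero integer, which makes x torsion.
    have hinf : M.Infinite := by
      intro hMfin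
      obtain ⟨u, hu, hu1, -⟩ := hΓ.expand (Classical.arbitrary ι)
      obtain ⟨k, l, hkl, hkl'⟩ := hMfin.exists_lt_map_eq_of_forall_mem
        (f := fun k : ℕ => u ^ k • x) fun k => hMinv ⟨u ^ k, pow_mem hu k⟩ x hx
      have hc : (u : R) ^ l - (u : R) ^ k ≠ 0 := by
        intro h0
        have h1 := congrArg (fun r => ‖p (Classical.arbitrary ι) (algebraMap R E r)‖)
          (sub_eq_zero.1 h0)
        simp only [map_pow, norm_pow] at h1
        exact hkl.ne' (pow_right_injective₀ (by linarith) hu1.ne' h1)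
      obtain ⟨d, n, hn, hd⟩ := hdvd _ hc
      refine hcon x (hMN hx) (isOfFinAddOrder_iff_nsmul_eq_zero.2 ⟨n, Nat.pos_of_ne_zero hn, ?_⟩)
      rw [← Nat.cast_smul_eq_nsmul R, ← hd, mul_smul, sub_smul]
      have : (u : R) ^ k • x = (u : R) ^ l • x := by
        simpa only [Units.smul_def, Units.val_pow_eq_pow_val] using hkl'
      rw [this, sub_self, smul_zero]
    refine ⟨x, hMN hx, fun r hr => hMN ?_⟩
    refine hΓ.add_mem_of_minimal hπ hπo hπs hM (fun ε hε => hMinv ⟨ε, hε⟩)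
      (fun M' h1 h2 h3 h4 => hmin M' h1 h2 h3 fun g => h4 g g.2) hinf ?_ hx
    rintro _ ⟨ε, -, rfl⟩
    exact hm' ε r hr
  -- Factorials make these closed sets decreasing, so compactness gives one x that serves for all
  -- torsion at once.
  set A : ℕ → Set T := fun n => {x | ∀ r : T, n.factorial • r = 0 → x + r ∈ N} with hA
  have hAcl n : IsClosed (A n) := by
    simp only [hA, ofPred_forall]
    exact isClosed_iInter fun r => isClosed_iInter fun _ => hN.preimage (by fun_prop)
  obtain ⟨x, hx⟩ : (⋂ n, A n).Nonempty := by
    refine IsCompact.nonempty_iInter_of_sequence_nonempty_isCompact_isClosed A (fun n x hx r hr =>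
      hx r ?_) (fun n => ?_) (hAcl 0).isCompact hAcl
    · rw [Nat.factorial_succ, mul_smul, hr, smul_zero]
    · obtain ⟨x, -, hx⟩ := hstep _ n.factorial_ne_zero
      exact ⟨x, hx⟩
  have htors : ∀ r ∈ AddCommGroup.torsion T, x + r ∈ N := by
    intro r hr
    obtain ⟨n, hn, hnr⟩ := isOfFinAddOrder_iff_nsmul_eq_zero.1 hr
    refine mem_iInter.1 hx n r ?_
    obtain ⟨q, hq⟩ := Nat.dvd_factorial hn le_rfl
    rw [hq, mul_comm, mul_smul, hnr, smul_zero]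
  have h0 : (0 : T) ∈ N := by
    have hcl : IsClosed {r | x + r ∈ N} := hN.preimage (by fun_prop)
    have := hcl.closure_subset_iff.2 htors (hdense (-x))
    simpa using this
  exact hcon 0 h0 (zero_mem _)

end IsExpanding

end Dynamics

/-! ### Completions at finite primes -/

section AdicCompletion

open HeightOneSpectrum

variable {K : Type u} [Field K] [NumberField K] (v : HeightOneSpectrum (𝓞 K))

lemma adicCompletion_norm_le_norm_iff {x y : v.adicCompletion K} :
    ‖x‖ ≤ ‖y‖ ↔ Valued.v x ≤ Valued.v y := by
  rw [FinitePlace.norm_def, FinitePlace.norm_def, NNReal.coe_le_coe,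
    (WithZeroMulInt.toNNReal_strictMono (one_lt_absNorm_nnreal v)).le_iff_le]

lemma adicCompletion_norm_le_one_iff {x : v.adicCompletion K} : ‖x‖ ≤ 1 ↔ Valued.v x ≤ 1 := by
  rw [← norm_one (α := v.adicCompletion K), adicCompletion_norm_le_norm_iff, map_one]

lemma adicCompletion_norm_lt_one_iff {x : v.adicCompletion K} : ‖x‖ < 1 ↔ Valued.v x < 1 := by
  rw [← norm_one (α := v.adicCompletion K), ← not_le, adicCompletion_norm_le_norm_iff, map_one,
    not_le]

lemma valued_algebraMap_adicCompletion (k : K) :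
    Valued.v (algebraMap K (v.adicCompletion K) k) = v.valuation K k :=
  valuedAdicCompletion_eq_valuation' v k

lemma exists_norm_of_valued_le (n : ℕ) :
    ∃ r : ℝ, 0 < r ∧ ∀ x : v.adicCompletion K, ‖x‖ ≤ r ↔ Valued.v x ≤ WithZero.exp (-(n : ℤ)) := by
  obtain ⟨ϖ, hϖ⟩ := v.valuation_exists_uniformizer K
  have h1 : Valued.v (algebraMap K (v.adicCompletion K) ϖ ^ n) = WithZero.exp (-(n : ℤ)) := by
    rw [map_pow, valued_algebraMap_adicCompletion, hϖ, ← WithZero.exp_nsmul]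
    simp
  refine ⟨‖algebraMap K (v.adicCompletion K) ϖ ^ n‖, norm_pos_iff.2 fun h0 => ?_, fun x => ?_⟩
  · rw [h0, map_zero] at h1
    exact WithZero.exp_ne_zero h1.symm
  · rw [adicCompletion_norm_le_norm_iff, h1]

lemma exists_valued_le_imp_norm_lt {ε : ℝ} (hε : 0 < ε) :
    ∃ n : ℕ, ∀ x : v.adicCompletion K, Valued.v x ≤ WithZero.exp (-(n : ℤ)) → ‖x‖ < ε := by
  obtain ⟨ϖ, hϖ⟩ := v.valuation_exists_uniformizer K
  have h1 (n : ℕ) : Valued.v (algebraMap K (v.adicCompletion K) ϖ ^ n) =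
      WithZero.exp (-(n : ℤ)) := by
    rw [map_pow, valued_algebraMap_adicCompletion, hϖ, ← WithZero.exp_nsmul]
    simp
  have h2 : ‖algebraMap K (v.adicCompletion K) ϖ‖ < 1 := by
    rw [adicCompletion_norm_lt_one_iff, valued_algebraMap_adicCompletion, hϖ, ← WithZero.exp_zero,
      WithZero.exp_lt_exp]
    norm_num
  obtain ⟨n, hn⟩ := exists_pow_lt_of_lt_one hε h2
  refine ⟨n, fun x hx => ?_⟩
  rw [← h1, ← adicCompletion_norm_le_norm_iff, norm_pow] at hx
  exact hx.trans_lt hn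

lemma exists_ringOfIntegers_sub_le {x : v.adicCompletion K} (hx : Valued.v x ≤ 1) (n : ℕ) :
    ∃ a : 𝓞 K, Valued.v (x - algebraMap K (v.adicCompletion K) a) ≤ WithZero.exp (-(n : ℤ)) := by
  obtain ⟨r, hr, hr'⟩ := exists_norm_of_valued_le v n
  obtain ⟨k, hk⟩ := Metric.denseRange_iff.1 (v.denseRange_algebraMap K) x r hr
  have hk' := (hr' _).1 (dist_eq_norm x _ ▸ hk.le)
  have hexp : (WithZero.exp (-(n : ℤ))) ≤ (1 : WithZero (Multiplicative ℤ)) := by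
    rw [← WithZero.exp_zero, WithZero.exp_le_exp]; simp
  have hk1 : v.valuation K k ≤ 1 := by
    rw [← valued_algebraMap_adicCompletion, ← sub_sub_cancel x (algebraMap K _ k)]
    exact (Valuation.map_sub _ _ _).trans (max_le hx (hk'.trans hexp))
  obtain ⟨a, ha⟩ := exists_valuation_sub_lt_of_integer v hk1
    (Units.mk0 (WithZero.exp (-(n : ℤ))) WithZero.exp_ne_zero)
  refine ⟨a, ?_⟩
  rw [← sub_sub_sub_cancel_right x _ (algebraMap K _ k), ← map_sub]
  refine (Valuation.map_sub _ _ _).trans (max_le hk' ?_)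
  rw [valued_algebraMap_adicCompletion]
  exact ha.le

/-- The unit ball is complete, and totally bounded because representatives of the finite ring 𝒪_K /
v^n approximate all its points. -/
lemma isCompact_adicCompletion_closedBall :
    IsCompact (Metric.closedBall (0 : v.adicCompletion K) 1) := by
  refine isCompact_iff_totallyBounded_isComplete.2 ⟨?_, Metric.isClosed_closedBall.isComplete⟩
  refine Metric.totallyBounded_iff.2 fun ε hε => ?_
  obtain ⟨n, hn⟩ := exists_valued_le_imp_norm_lt v hε
  have : Finite (𝓞 K ⧸ v.asIdeal ^ n) :=
    Ideal.finiteQuotientOfFreeOfNeBot _ (pow_ne_zero n v.ne_bot)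
  refine ⟨range fun q : 𝓞 K ⧸ v.asIdeal ^ n =>
    algebraMap K (v.adicCompletion K) (Quotient.out q : 𝓞 K), finite_range _, fun x hx => ?_⟩
  rw [mem_closedBall_zero_iff, adicCompletion_norm_le_one_iff] at hx
  obtain ⟨a, ha⟩ := exists_ringOfIntegers_sub_le v hx n
  refine mem_iUnion₂.2 ⟨_, ⟨Ideal.Quotient.mk _ a, rfl⟩, ?_⟩
  set b : 𝓞 K := Quotient.out (Ideal.Quotient.mk (v.asIdeal ^ n) a) with hb
  have hab : a - b ∈ v.asIdeal ^ n := by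
    rw [← Ideal.Quotient.eq, hb]
    exact (Quotient.out_eq _).symm
  rw [Metric.mem_ball, dist_eq_norm]
  apply hn
  rw [← sub_add_sub_cancel _ (algebraMap K (v.adicCompletion K) a)]
  refine (Valuation.map_add _ _ _).trans (max_le ha ?_)
  rw [← map_sub, valued_algebraMap_adicCompletion, ← map_sub (algebraMap (𝓞 K) K),
    valuation_of_algebraMap, intValuation_le_pow_iff_mem]
  exact hab

instance : LocallyCompactSpace (v.adicCompletion K) :=
  (isCompact_adicCompletion_closedBall v).locallyCompactSpace_of_mem_nhds_of_addGroup
    (Metric.closedBall_mem_nhds 0 one_pos)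

lemma valuation_natCast_lt_one {n : ℕ} (h : Ideal.absNorm v.asIdeal ∣ n) :
    v.valuation K (n : K) < 1 := by
  have : ((n : 𝓞 K) : K) = n := by simp
  rw [← this, valuation_lt_one_iff_mem]
  exact Ideal.mem_of_dvd v.asIdeal (Nat.cast_dvd_cast h) (Ideal.absNorm_mem v.asIdeal)

variable {v}

/-- The class group is finite, so its order can serve as the exponent. The generator is a unit away
from v. -/
lemma exists_span_singleton_eq_pow (v : HeightOneSpectrum (𝓞 K)) :
    ∃ a : 𝓞 K, ∃ h : ℕ, 0 < h ∧ a ≠ 0 ∧ Ideal.span {a} = v.asIdeal ^ h := by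
  have hv : v.asIdeal ∈ nonZeroDivisors (Ideal (𝓞 K)) := mem_nonZeroDivisors_of_ne_zero v.ne_bot
  have h1 : (v.asIdeal ^ Fintype.card (ClassGroup (𝓞 K))).IsPrincipal := by
    rw [← ClassGroup.mk0_eq_one_iff (pow_mem hv _)]
    have : (⟨v.asIdeal ^ Fintype.card (ClassGroup (𝓞 K)), pow_mem hv _⟩ :
        nonZeroDivisors (Ideal (𝓞 K))) = ⟨v.asIdeal, hv⟩ ^ Fintype.card (ClassGroup (𝓞 K)) := rfl
    rw [this, map_pow, pow_card_eq_one]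
  obtain ⟨a, ha⟩ := h1
  refine ⟨a, _, Fintype.card_pos, ?_, ha.symm⟩
  rintro rfl
  exact pow_ne_zero _ v.ne_bot (ha.trans (Ideal.span_singleton_eq_bot.2 rfl))

lemma valuation_lt_one_of_span_eq {a : 𝓞 K} {h : ℕ} (hh : 0 < h)
    (ha : Ideal.span {a} = v.asIdeal ^ h) : v.valuation K (a : K) < 1 := by
  rw [valuation_lt_one_iff_mem]
  exact Ideal.pow_le_self hh.ne' (ha ▸ Ideal.mem_span_singleton_self a)

lemma valuation_eq_one_of_span_eq {a : 𝓞 K} {h : ℕ} (ha : Ideal.span {a} = v.asIdeal ^ h)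
    {w : HeightOneSpectrum (𝓞 K)} (hw : w ≠ v) : w.valuation K (a : K) = 1 := by
  rw [valuation_eq_one_iff_notMem]
  intro hmem
  have h1 : v.asIdeal ^ h ≤ w.asIdeal := by
    rwa [← ha, Ideal.span_singleton_le_iff_mem]
  exact hw (HeightOneSpectrum.ext
    (v.isMaximal.eq_of_le w.isPrime.ne_top (w.isPrime.le_of_pow_le h1)).symm)

lemma exists_contracting (S₀ : Finset (HeightOneSpectrum (𝓞 K))) :
    ∃ a : 𝓞 K, a ≠ 0 ∧ (∀ v ∈ S₀, v.valuation K (a : K) < 1) ∧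
      ∀ v ∉ S₀, v.valuation K (a : K) = 1 := by
  classical
  choose a h hh ha0 ha using exists_span_singleton_eq_pow (K := K)
  have hprod : ((∏ v ∈ S₀, a v : 𝓞 K) : K) = ∏ v ∈ S₀, (a v : K) :=
    map_prod (algebraMap (𝓞 K) K) _ _
  refine ⟨∏ v ∈ S₀, a v, Finset.prod_ne_zero_iff.2 fun v _ => ha0 v, fun v hv => ?_, fun v hv => ?_⟩
  · rw [hprod, map_prod, ← Finset.mul_prod_erase _ _ hv]
    refine mul_lt_one_of_lt_of_le (valuation_lt_one_of_span_eq (hh v) (ha v)) ?_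
    exact Finset.prod_le_one' fun w _ => v.valuation_le_one _
  · rw [hprod, map_prod]
    exact Finset.prod_eq_one fun w hw => valuation_eq_one_of_span_eq (ha w) (by
      rintro rfl; exact hv hw)

end AdicCompletion

/-! ### The S-integers in the product of completions -/

section SCompletion

open HeightOneSpectrum

variable {K : Type u} [Field K] [NumberField K] {S₀ : Finset (HeightOneSpectrum (𝓞 K))}

instance : T2Space (InfiniteAdeleRing K) :=
  inferInstanceAs (T2Space ((v : InfinitePlace K) → v.Completion))

/-- The `S`-unit given by an element of `K` that is a unit at all finite primes outside of `S`. -/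
noncomputable def sUnit (x : K) (hx0 : x ≠ 0) (hx : ∀ v ∉ S₀, v.valuation K x = 1) : (SInt K S₀)ˣ :=
  (S₀ : Set (HeightOneSpectrum (𝓞 K))).unitEquivUnitsInteger K ⟨Units.mk0 x hx0, hx⟩

lemma exists_forall_ringOfIntegers_sub_le (y : (v : S₀) → v.1.adicCompletion K)
    (hy : ∀ v, Valued.v (y v) ≤ 1) (n : ℕ) :
    ∃ a : 𝓞 K, ∀ v : S₀, Valued.v (y v - algebraMap K (v.1.adicCompletion K) a) ≤
      WithZero.exp (-(n : ℤ)) := by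
  choose b hb using fun v : S₀ => exists_ringOfIntegers_sub_le v.1 (hy v) n
  obtain ⟨a, ha⟩ := IsDedekindDomain.exists_forall_sub_mem_ideal (s := S₀)
    (fun v => v.asIdeal) (fun _ => n) (fun v _ => v.prime)
    (fun v _ w _ hvw h => hvw (HeightOneSpectrum.ext h)) b
  refine ⟨a, fun v => ?_⟩
  rw [← sub_sub_sub_cancel_right _ _ (algebraMap K (v.1.adicCompletion K) (b v))]
  refine (Valuation.map_sub _ _ _).trans (max_le (hb v) ?_)
  rw [← map_sub, valued_algebraMap_adicCompletion, ← map_sub (algebraMap (𝓞 K) K),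
    valuation_of_algebraMap, intValuation_le_pow_iff_mem]
  exact ha v.1 v.2

/-- Multiplication by a power of an S-unit ϖ makes y integral. Approximation in 𝒪_K to sufficient
precision, followed by division by that power, leaves an integral error. -/
lemma exists_sInt_sub_le (y : (v : S₀) → v.1.adicCompletion K) :
    ∃ k : SInt K S₀, ∀ v : S₀, Valued.v (y v - algebraMap K (v.1.adicCompletion K) k) ≤ 1 := by
  obtain ⟨ϖ, hϖ0, hϖ1, hϖ2⟩ := exists_contracting S₀
  have hϖK : (ϖ : K) ≠ 0 := by simpa using hϖ0
  have hlim (v : S₀) : Tendsto (fun n : ℕ => algebraMap K (v.1.adicCompletion K) ϖ ^ n * y v)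
      atTop (𝓝 0) := by
    have h1 : Tendsto (fun n : ℕ => algebraMap K (v.1.adicCompletion K) ϖ ^ n) atTop (𝓝 0) :=
      tendsto_pow_atTop_nhds_zero_of_norm_lt_one (by
        rw [adicCompletion_norm_lt_one_iff, valued_algebraMap_adicCompletion]
        exact hϖ1 v v.2)
    simpa using h1.mul_const (y v)
  obtain ⟨n, hn⟩ := (eventually_all.2 fun v : S₀ => (hlim v).eventually
    (Metric.closedBall_mem_nhds 0 one_pos)).exists
  obtain ⟨m, hm⟩ : ∃ m : ℕ, ∀ v : S₀, WithZero.exp (-(m : ℤ)) ≤ v.1.valuation K (ϖ ^ n : K) := by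
    have hv (v : S₀) : ∃ m : ℕ, WithZero.exp (-(m : ℤ)) ≤ v.1.valuation K (ϖ ^ n : K) := by
      have h0 : v.1.valuation K (ϖ ^ n : K) ≠ 0 := by simpa using fun h => absurd h hϖ0
      refine ⟨(WithZero.log (v.1.valuation K (ϖ ^ n : K))).natAbs, ?_⟩
      rw [← WithZero.le_log_iff_exp_le h0]
      omega
    choose m hm using hv
    refine ⟨Finset.univ.sup m, fun v => le_trans ?_ (hm v)⟩
    rw [WithZero.exp_le_exp]
    have := Finset.le_sup (f := m) (Finset.mem_univ v)
    omega
  obtain ⟨a, ha⟩ := exists_forall_ringOfIntegers_sub_le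
    (fun v => algebraMap K (v.1.adicCompletion K) ϖ ^ n * y v)
    (fun v => (adicCompletion_norm_le_one_iff _).1 (by simpa using hn v)) m
  refine ⟨⟨(a : K) / ϖ ^ n, fun v hv => ?_⟩, fun v => ?_⟩
  · rw [map_div₀, map_pow, hϖ2 v hv, one_pow, div_one]
    exact v.valuation_le_one a
  · have h1 := (ha v).trans (hm v)
    have h0 : algebraMap K (v.1.adicCompletion K) ϖ ^ n ≠ 0 := by simpa using fun h => absurd h hϖ0
    have h2 : y v - algebraMap K (v.1.adicCompletion K) ((a : K) / ϖ ^ n) =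
        (algebraMap K (v.1.adicCompletion K) ϖ ^ n * y v - algebraMap K _ a) /
          algebraMap K (v.1.adicCompletion K) ϖ ^ n := by
      rw [map_div₀, map_pow]; field_simp
    have h3 : Valued.v (algebraMap K (v.1.adicCompletion K) ϖ ^ n) =
        v.1.valuation K (ϖ ^ n : K) := by
      rw [← map_pow, valued_algebraMap_adicCompletion]
    rw [h2, map_div₀, h3]
    exact div_le_one_of_le₀ h1 zero_le

/-- 𝒪_K is a full lattice in the Minkowski space, and its fundamental domain is bounded. -/
lemma exists_infiniteAdele_bound (K : Type u) [Field K] [NumberField K] :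
    ∃ r : ℝ, ∀ x : InfiniteAdeleRing K, ∃ a : 𝓞 K, ∀ v : InfinitePlace K,
      ‖(x - algebraMap K (InfiniteAdeleRing K) a) v‖ ≤ r := by
  classical
  obtain ⟨r, hr⟩ := (isBounded_iff_forall_norm_le (E := mixedEmbedding.mixedSpace K)).1
    (ZSpan.fundamentalDomain_isBounded (K := ℝ) (E := mixedEmbedding.mixedSpace K)
      (mixedEmbedding.latticeBasis K))
  refine ⟨r, fun x => ?_⟩
  set y := InfiniteAdeleRing.ringEquiv_mixedSpace K x
  have hfl := (ZSpan.floor (mixedEmbedding.latticeBasis K) y).2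
  rw [mixedEmbedding.mem_span_latticeBasis] at hfl
  obtain ⟨a, ha⟩ := hfl
  have hn := hr _ (ZSpan.fract_mem_fundamentalDomain (mixedEmbedding.latticeBasis K) y)
  have hn' : ‖InfiniteAdeleRing.ringEquiv_mixedSpace K
      (x - algebraMap K (InfiniteAdeleRing K) (a : K))‖ ≤ r := by
    have he : InfiniteAdeleRing.ringEquiv_mixedSpace K
        (x - algebraMap K (InfiniteAdeleRing K) (a : K)) =
        ZSpan.fract (mixedEmbedding.latticeBasis K) y := by
      rw [map_sub, ← InfiniteAdeleRing.mixedEmbedding_eq_algebraMap_comp, ZSpan.fract_apply, ← ha]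
      rfl
    rw [he]
    exact hn
  refine ⟨a, fun v => ?_⟩
  set z := x - algebraMap K (InfiniteAdeleRing K) (a : K)
  by_cases hv : v.IsReal
  · have h1 := (norm_le_pi_norm _ (⟨v, hv⟩ : {w : InfinitePlace K // w.IsReal})).trans
      ((norm_fst_le _).trans hn')
    rw [InfiniteAdeleRing.ringEquiv_mixedSpace_apply] at h1
    rwa [← (AddMonoidHomClass.isometry_iff_norm _).1
      (InfinitePlace.Completion.isometry_extensionEmbeddingOfIsReal hv)]
  · rw [InfinitePlace.not_isReal_iff_isComplex] at hv
    have h1 := (norm_le_pi_norm _ (⟨v, hv⟩ : {w : InfinitePlace K // w.IsComplex})).trans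
      ((norm_snd_le _).trans hn')
    rw [InfiniteAdeleRing.ringEquiv_mixedSpace_apply] at h1
    rwa [← (AddMonoidHomClass.isometry_iff_norm _).1
      (InfinitePlace.Completion.isometry_extensionEmbedding v)]

omit [NumberField K] in
lemma isCompact_infiniteAdele_ball (r : ℝ) :
    IsCompact {x : InfiniteAdeleRing K | ∀ v : InfinitePlace K, ‖x v‖ ≤ r} := by
  have h1 (v : InfinitePlace K) : IsCompact {x : v.Completion | ‖x‖ ≤ r} := by
    have h2 := (InfinitePlace.Completion.isometry_extensionEmbedding v).isClosedEmbedding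
      |>.isCompact_preimage (isCompact_closedBall (0 : ℂ) r)
    convert h2 using 1
    ext x
    rw [mem_preimage, mem_closedBall_zero_iff, (AddMonoidHomClass.isometry_iff_norm _).1
      (InfinitePlace.Completion.isometry_extensionEmbedding v)]
    rfl
  have h3 : IsCompact (Set.pi univ fun v : InfinitePlace K => {x : v.Completion | ‖x‖ ≤ r}) :=
    isCompact_univ_pi h1
  have h4 : (Set.pi univ fun v : InfinitePlace K => {x : v.Completion | ‖x‖ ≤ r}) =
      {x : (v : InfinitePlace K) → v.Completion | ∀ v, ‖x v‖ ≤ r} := by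
    ext x; simp
  rw [h4] at h3
  exact h3

instance : LocallyCompactSpace (SCompletion K S₀) := by
  have : LocallyCompactSpace ((v : S₀) → v.1.adicCompletion K) :=
    Pi.locallyCompactSpace_of_finite
  infer_instance

/-- The ring of `S`-integers is cocompact in the product of the completions. -/
lemma exists_isCompact_sub_mem (K : Type u) [Field K] [NumberField K]
    (S₀ : Finset (HeightOneSpectrum (𝓞 K))) :
    ∃ C : Set (SCompletion K S₀), IsCompact C ∧
      ∀ x, ∃ k : SInt K S₀, x - algebraMap (SInt K S₀) (SCompletion K S₀) k ∈ C := by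
  obtain ⟨r, hr⟩ := exists_infiniteAdele_bound K
  refine ⟨{x : InfiniteAdeleRing K | ∀ v : InfinitePlace K, ‖x v‖ ≤ r} ×ˢ
    Set.pi univ fun v : S₀ => Metric.closedBall (0 : v.1.adicCompletion K) 1,
    (isCompact_infiniteAdele_ball r).prod (isCompact_univ_pi fun v =>
      isCompact_adicCompletion_closedBall v.1), fun x => ?_⟩
  obtain ⟨k, hk⟩ := exists_sInt_sub_le x.2
  obtain ⟨a, ha⟩ := hr (x.1 - algebraMap K _ (k : K))
  refine ⟨k + algebraMap (𝓞 K) (SInt K S₀) a, ?_⟩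
  have h1 : algebraMap (SInt K S₀) (SCompletion K S₀) (k + algebraMap (𝓞 K) (SInt K S₀) a) =
      algebraMap K (SCompletion K S₀) k + algebraMap K (SCompletion K S₀) (a : K) :=
    map_add (algebraMap K (SCompletion K S₀)) _ _
  rw [h1]
  refine ⟨fun v => ?_, fun v _ => ?_⟩
  · have := ha v
    rwa [sub_sub] at this
  · rw [mem_closedBall_zero_iff, adicCompletion_norm_le_one_iff]
    change Valued.v (x.2 v - (algebraMap K (v.1.adicCompletion K) k + algebraMap K _ (a : K))) ≤ 1
    rw [← sub_sub]
    refine (Valuation.map_sub _ _ _).trans (max_le (hk v) ?_)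
    rw [valued_algebraMap_adicCompletion]
    exact v.1.valuation_le_one a

/-- The ring of `S`-integers is discrete in the product of the completions. -/
lemma exists_nhds_algebraMap_mem (K : Type u) [Field K] [NumberField K]
    (S₀ : Finset (HeightOneSpectrum (𝓞 K))) :
    ∃ U ∈ 𝓝 (0 : SCompletion K S₀), ∀ k : SInt K S₀,
      algebraMap (SInt K S₀) (SCompletion K S₀) k ∈ U → k = 0 := by
  have h1 : {x : InfiniteAdeleRing K | ∀ v : InfinitePlace K, ‖x v‖ < 1} ∈
      𝓝 (0 : InfiniteAdeleRing K) := by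
    have : (Set.pi univ fun v : InfinitePlace K => {x : v.Completion | ‖x‖ < 1}) ∈
        𝓝 (0 : (v : InfinitePlace K) → v.Completion) :=
      set_pi_mem_nhds finite_univ fun v _ =>
        (isOpen_lt continuous_norm continuous_const).mem_nhds (by simp)
    have h0 : (Set.pi univ fun v : InfinitePlace K => {x : v.Completion | ‖x‖ < 1}) =
        {x : (v : InfinitePlace K) → v.Completion | ∀ v, ‖x v‖ < 1} := by
      ext x; simp
    rw [h0] at this
    exact this
  have h2 : (Set.pi univ fun v : S₀ => Metric.closedBall (0 : v.1.adicCompletion K) 1) ∈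
      𝓝 (0 : (v : S₀) → v.1.adicCompletion K) :=
    set_pi_mem_nhds finite_univ fun v _ => Metric.closedBall_mem_nhds _ one_pos
  refine ⟨_, prod_mem_nhds h1 h2, fun k hk => ?_⟩
  -- Such a k is integral everywhere, and a nonzero algebraic integer cannot be smaller than 1 at
  -- all infinite places.
  obtain ⟨a, ha⟩ := mem_integers_of_valuation_le_one K (k : K) fun v => by
    by_cases hv : v ∈ S₀
    · have := hk.2 ⟨v, hv⟩ (mem_univ _)
      rw [mem_closedBall_zero_iff, adicCompletion_norm_le_one_iff] at this
      rwa [← valued_algebraMap_adicCompletion]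
    · exact k.2 v hv
  have hlt (v : InfinitePlace K) : v a < 1 := by
    have : ‖((k : K) : v.Completion)‖ < 1 := hk.1 v
    rw [← ha] at this
    exact (InfinitePlace.Completion.norm_coe v _).symm.trans_lt this
  have ha0 : a = 0 := by
    by_contra h0
    exact (hlt (Classical.arbitrary _)).not_ge
      (InfinitePlace.one_le_of_lt_one h0 fun w _ => hlt w)
  ext
  rw [← ha, ha0, map_zero]
  rfl

lemma denseRange_algebraMap_pi_adicCompletion (K : Type u) [Field K] [NumberField K]
    (S₀ : Finset (HeightOneSpectrum (𝓞 K))) :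
    DenseRange (algebraMap K ((v : S₀) → v.1.adicCompletion K)) := by
  refine Metric.denseRange_iff.2 fun y ε hε => ?_
  obtain ⟨k, hk⟩ := exists_sInt_sub_le y
  choose n hn using fun v : S₀ => exists_valued_le_imp_norm_lt v.1 hε
  obtain ⟨a, ha⟩ := exists_forall_ringOfIntegers_sub_le _ hk (Finset.univ.sup n)
  refine ⟨k + a, (dist_pi_lt_iff hε).2 fun v => ?_⟩
  rw [dist_eq_norm]
  apply hn
  have h1 : algebraMap K ((v : S₀) → v.1.adicCompletion K) ((k : K) + a) v =
    algebraMap K (v.1.adicCompletion K) k + algebraMap K _ (a : K) :=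
    map_add (algebraMap K (v.1.adicCompletion K)) _ _
  rw [h1, ← sub_sub]
  refine (ha v).trans ?_
  rw [WithZero.exp_le_exp]
  have := Finset.le_sup (f := n) (Finset.mem_univ v)
  omega

/-- Weak approximation for the primes in `S`. -/
lemma denseRange_algebraMap_sCompletion (K : Type u) [Field K] [NumberField K]
    (S₀ : Finset (HeightOneSpectrum (𝓞 K))) :
    DenseRange (algebraMap K (SCompletion K S₀)) := by
  -- N is small at each finite prime of S and large at the infinite ones, so (1 + N^n)⁻¹ tends to 1
  -- and 0 there, respectively. The factor 2 keeps N > 1 even when S₀ is empty.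
  set N : ℕ := 2 * ∏ v ∈ S₀, Ideal.absNorm v.asIdeal with hN
  have hN2 : 1 < N := by
    have : 0 < ∏ v ∈ S₀, Ideal.absNorm v.asIdeal := Finset.prod_pos fun v _ =>
      Nat.pos_of_ne_zero (by simpa [Ideal.absNorm_eq_zero_iff] using v.ne_bot)
    omega
  have hfin (v : S₀) : Tendsto (fun n : ℕ => algebraMap K (v.1.adicCompletion K)
      ((1 + (N : K) ^ n)⁻¹)) atTop (𝓝 1) := by
    have h1 : Tendsto (fun n : ℕ => algebraMap K (v.1.adicCompletion K) N ^ n) atTop (𝓝 0) :=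
      tendsto_pow_atTop_nhds_zero_of_norm_lt_one (by
        rw [adicCompletion_norm_lt_one_iff, valued_algebraMap_adicCompletion]
        exact valuation_natCast_lt_one _ ((Finset.dvd_prod_of_mem _ v.2).mul_left 2))
    have h2 := (h1.const_add 1).inv₀ (by simp)
    simpa using h2
  have hinf (v : InfinitePlace K) : Tendsto (fun n : ℕ => algebraMap K v.Completion
      ((1 + (N : K) ^ n)⁻¹)) atTop (𝓝 0) := by
    rw [tendsto_zero_iff_norm_tendsto_zero]
    have h1 (n : ℕ) : ‖algebraMap K v.Completion ((1 + (N : K) ^ n)⁻¹)‖ =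
        (((1 + N ^ n : ℕ) : ℝ))⁻¹ := by
      have h2 : ‖algebraMap K v.Completion ((1 + (N : K) ^ n)⁻¹)‖ = v ((1 + (N : K) ^ n)⁻¹) :=
        InfinitePlace.Completion.norm_coe v _
      rw [h2, map_inv₀, ← InfinitePlace.norm_embedding_eq]
      congr 1
      rw [← Complex.norm_natCast]
      simp
    simp_rw [h1]
    refine tendsto_inv_atTop_zero.comp (tendsto_natCast_atTop_atTop.comp ?_)
    exact tendsto_atTop_mono (fun n => Nat.le_add_left _ _) (tendsto_pow_atTop_atTop_of_one_lt hN2)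
  have hpair (k l : K) : ((algebraMap K (InfiniteAdeleRing K) k,
      algebraMap K ((v : S₀) → v.1.adicCompletion K) l) : SCompletion K S₀) ∈
      closure (range (algebraMap K (SCompletion K S₀))) := by
    refine mem_closure_of_tendsto (f := fun n : ℕ => algebraMap K (SCompletion K S₀)
      (k + (l - k) * (1 + (N : K) ^ n)⁻¹)) (b := atTop) ?_
      (Eventually.of_forall fun n => mem_range_self _)
    refine Prod.tendsto_iff _ _ |>.2 ⟨?_, ?_⟩
    · refine tendsto_pi_nhds.2 fun v => ?_
      have h1 := ((hinf v).const_mul (algebraMap K v.Completion (l - k))).const_add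
        (algebraMap K v.Completion k)
      rw [mul_zero, add_zero] at h1
      refine h1.congr fun n => ?_
      rw [← map_mul, ← map_add]
      rfl
    · refine tendsto_pi_nhds.2 fun v => ?_
      have h1 := ((hfin v).const_mul (algebraMap K (v.1.adicCompletion K) (l - k))).const_add
        (algebraMap K (v.1.adicCompletion K) k)
      rw [mul_one, ← map_add, add_sub_cancel] at h1
      refine h1.congr fun n => ?_
      rw [← map_mul, ← map_add]
      rfl
  have hdense := (InfiniteAdeleRing.denseRange_algebraMap K).prodMap
    (denseRange_algebraMap_pi_adicCompletion K S₀)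
  refine dense_closure.1 (hdense.mono ?_)
  rintro _ ⟨⟨k, l⟩, rfl⟩
  exact hpair k l

end SCompletion

/-! ### The quotient by an ideal -/

section STorus

open HeightOneSpectrum

variable {K : Type u} [Field K] [NumberField K] {S₀ : Finset (HeightOneSpectrum (𝓞 K))}

lemma exists_natCast_mul_eq_ringOfIntegers (k : K) :
    ∃ n : ℕ, n ≠ 0 ∧ ∃ a : 𝓞 K, (n : K) * k = a := by
  obtain ⟨a, b, hb, rfl⟩ := IsFractionRing.div_surjective (A := 𝓞 K) k
  have hb0 : b ≠ 0 := nonZeroDivisors.ne_zero hb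
  obtain ⟨c, hc⟩ := Ideal.mem_span_singleton'.1 (Ideal.absNorm_mem (Ideal.span {b}))
  refine ⟨Ideal.absNorm (Ideal.span {b}), by simpa [Ideal.absNorm_eq_zero_iff] using hb0,
    c * a, ?_⟩
  have hc' : (c : K) * (b : K) = (Ideal.absNorm (Ideal.span {b}) : ℕ) := by
    rw [← map_mul, hc, map_natCast]
  have hbK : (b : K) ≠ 0 := by simpa using hb0
  rw [← hc', show ((c * a : 𝓞 K) : K) = (c : K) * (a : K) from map_mul _ c a]
  field_simp

lemma exists_mul_eq_natCast (c : SInt K S₀) (hc : c ≠ 0) :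
    ∃ d : SInt K S₀, ∃ n : ℕ, n ≠ 0 ∧ d * c = n := by
  obtain ⟨n, hn, a, ha⟩ := exists_natCast_mul_eq_ringOfIntegers (c : K)⁻¹
  have hcK : (c : K) ≠ 0 := fun h => hc (Subtype.ext h)
  refine ⟨algebraMap (𝓞 K) (SInt K S₀) a, n, hn, Subtype.ext ?_⟩
  change (a : K) * (c : K) = ((n : SInt K S₀) : K)
  rw [← ha, mul_assoc, inv_mul_cancel₀ hcK, mul_one]
  simp

lemma exists_natCast_mem {𝔞 : Ideal (SInt K S₀)} (h𝔞 : 𝔞 ≠ ⊥) :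
    ∃ n : ℕ, n ≠ 0 ∧ (n : SInt K S₀) ∈ 𝔞 := by
  obtain ⟨c, hc, hc0⟩ := Submodule.exists_mem_ne_zero_of_ne_bot h𝔞
  obtain ⟨d, n, hn, h⟩ := exists_mul_eq_natCast c hc0
  exact ⟨n, hn, h ▸ 𝔞.mul_mem_left d hc⟩

lemma mkQ_algebraMap_mem_torsion {𝔞 : Ideal (SInt K S₀)} (h𝔞 : 𝔞 ≠ ⊥) (k : K) :
    (diagIdeal 𝔞).mkQ (algebraMap K (SCompletion K S₀) k) ∈ AddCommGroup.torsion (STorus 𝔞) := by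
  obtain ⟨n, hn, hn𝔞⟩ := exists_natCast_mem h𝔞
  obtain ⟨m, hm, a, ha⟩ := exists_natCast_mul_eq_ringOfIntegers k
  refine isOfFinAddOrder_iff_nsmul_eq_zero.2 ⟨n * m, by positivity, ?_⟩
  rw [← map_nsmul, Submodule.mkQ_apply, Submodule.Quotient.mk_eq_zero]
  refine ⟨n * algebraMap (𝓞 K) (SInt K S₀) a, 𝔞.mul_mem_right _ hn𝔞, ?_⟩
  have : ((n * algebraMap (𝓞 K) (SInt K S₀) a : SInt K S₀) : K) = (n * m : ℕ) * k := by
    push_cast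
    rw [mul_assoc, ha]
  change algebraMap K (SCompletion K S₀) ((n * algebraMap (𝓞 K) (SInt K S₀) a : SInt K S₀) : K) = _
  rw [this, map_mul, map_natCast, nsmul_eq_mul]

lemma dense_torsion_sTorus {𝔞 : Ideal (SInt K S₀)} (h𝔞 : 𝔞 ≠ ⊥) :
    Dense (AddCommGroup.torsion (STorus 𝔞) : Set (STorus 𝔞)) := by
  have h1 := (Submodule.mkQ_surjective (diagIdeal 𝔞)).denseRange.comp
    (denseRange_algebraMap_sCompletion K S₀) (Submodule.continuous_mkQ (diagIdeal 𝔞))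
  refine h1.mono ?_
  rintro _ ⟨k, rfl⟩
  exact mkQ_algebraMap_mem_torsion h𝔞 k

instance (𝔞 : Ideal (SInt K S₀)) : ContinuousConstSMul (SInt K S₀) (STorus 𝔞) where
  continuous_const_smul c := by
    refine (Submodule.isQuotientMap_mkQ (diagIdeal 𝔞)).continuous_iff.2 ?_
    exact (Submodule.continuous_mkQ (diagIdeal 𝔞)).comp
      (continuous_const_smul c : Continuous fun x : SCompletion K S₀ => c • x)

/-- If C meets every coset of 𝒪_S and n is a nonzero integer in 𝔞, then nC meets every coset of 𝔞.
-/
lemma compactSpace_sTorus {𝔞 : Ideal (SInt K S₀)} (h𝔞 : 𝔞 ≠ ⊥) : CompactSpace (STorus 𝔞) := by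
  obtain ⟨n, hn, hn𝔞⟩ := exists_natCast_mem h𝔞
  obtain ⟨C, hC, hC'⟩ := exists_isCompact_sub_mem K S₀
  have himage : (fun x => (diagIdeal 𝔞).mkQ ((n : SCompletion K S₀) * x)) '' C = univ := by
    refine eq_univ_of_forall fun y => ?_
    obtain ⟨x, rfl⟩ := Submodule.mkQ_surjective _ y
    obtain ⟨k, hk⟩ := hC' (algebraMap K (SCompletion K S₀) (n : K)⁻¹ * x)
    refine ⟨_, hk, ?_⟩
    have h1 : (n : SCompletion K S₀) * algebraMap K (SCompletion K S₀) (n : K)⁻¹ = 1 := by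
      rw [← map_natCast (algebraMap K (SCompletion K S₀)), ← map_mul, mul_inv_cancel₀ (by simpa),
        map_one]
    have h2 : (diagIdeal 𝔞).mkQ ((n : SCompletion K S₀) * algebraMap (SInt K S₀) _ k) = 0 := by
      rw [Submodule.mkQ_apply, Submodule.Quotient.mk_eq_zero]
      exact ⟨n * k, 𝔞.mul_mem_right _ hn𝔞, by simp⟩
    change (diagIdeal 𝔞).mkQ ((n : SCompletion K S₀) * _) = _
    rw [mul_sub, map_sub, h2, sub_zero, ← mul_assoc, h1, one_mul]
  refine ⟨himage ▸ hC.image ?_⟩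
  exact (Submodule.continuous_mkQ _).comp (continuous_const.mul continuous_id)

lemma isClosed_diagIdeal (𝔞 : Ideal (SInt K S₀)) :
    IsClosed (diagIdeal 𝔞 : Set (SCompletion K S₀)) := by
  obtain ⟨U, hU, hU'⟩ := exists_nhds_algebraMap_mem K S₀
  have : DiscreteTopology (diagIdeal 𝔞).toAddSubgroup := by
    refine discreteTopology_of_isOpen_singleton_zero ?_
    obtain ⟨V, hVU, hV, hV0⟩ := mem_nhds_iff.1 hU
    refine ⟨V, hV, ?_⟩
    ext x
    refine ⟨fun hx => ?_, fun hx => ?_⟩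
    · obtain ⟨x, k, hk, rfl⟩ := x
      have := hU' k (hVU hx)
      subst this
      exact Subtype.ext (map_zero _)
    · rw [mem_singleton_iff.1 hx]
      exact hV0
  exact AddSubgroup.isClosed_of_discrete (H := (diagIdeal 𝔞).toAddSubgroup)

instance (𝔞 : Ideal (SInt K S₀)) : T2Space (STorus 𝔞) := by
  have := isClosed_diagIdeal 𝔞
  have : T3Space (STorus 𝔞) := Submodule.t3_quotient_of_isClosed (diagIdeal 𝔞)
  exact @T25Space.t2Space _ _ T3Space.t25Space

/-- The kernel of n is compact, and discrete as well: if e is small and ne lies in the discrete 𝔞,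
then ne = 0 and e = 0. -/
lemma finite_setOf_nsmul_eq_zero {𝔞 : Ideal (SInt K S₀)} (h𝔞 : 𝔞 ≠ ⊥) {n : ℕ} (hn : n ≠ 0) :
    {x : STorus 𝔞 | n • x = 0}.Finite := by
  have := compactSpace_sTorus h𝔞
  set H : AddSubgroup (STorus 𝔞) := (nsmulAddMonoidHom n).ker
  have hmem (x : STorus 𝔞) : x ∈ H ↔ n • x = 0 := Iff.rfl
  have hcl : IsClosed (H : Set (STorus 𝔞)) :=
    isClosed_eq (continuous_const_smul n) continuous_const
  have : CompactSpace H := isCompact_iff_compactSpace.1 hcl.isCompact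
  obtain ⟨U, hU, hU'⟩ := exists_nhds_algebraMap_mem K S₀
  have : DiscreteTopology H := by
    have hV : {x : SCompletion K S₀ | n • x ∈ U} ∈ 𝓝 (0 : SCompletion K S₀) :=
      (continuous_const_smul n : Continuous fun x : SCompletion K S₀ => n • x).continuousAt
        |>.preimage_mem_nhds (by rwa [smul_zero])
    obtain ⟨V, hVU, hV, hV0⟩ := mem_nhds_iff.1 hV
    refine discreteTopology_of_isOpen_singleton_zero
      ⟨(diagIdeal 𝔞).mkQ '' V, Submodule.isOpenMap_mkQ _ _ hV, ?_⟩
    ext ⟨x, hx⟩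
    refine ⟨?_, fun h0 => ⟨0, hV0, ?_⟩⟩
    · rintro ⟨e, he, rfl⟩
      rw [hmem, ← map_nsmul, Submodule.mkQ_apply, Submodule.Quotient.mk_eq_zero] at hx
      obtain ⟨k, hk, hke⟩ := hx
      have hk0 := hU' k (by
        change Algebra.linearMap (SInt K S₀) (SCompletion K S₀) k ∈ U
        rw [hke]
        exact hVU he)
      rw [hk0, map_zero, eq_comm, nsmul_eq_mul,
        ← map_natCast (algebraMap K (SCompletion K S₀))] at hke
      have he0 : e = 0 := by
        rw [← one_mul e, ← map_one (algebraMap K (SCompletion K S₀)),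
          ← inv_mul_cancel₀ (Nat.cast_ne_zero.2 hn : (n : K) ≠ 0), map_mul, mul_assoc, hke,
          mul_zero]
      subst he0
      exact Subtype.ext (map_zero _)
    · rw [map_zero]
      exact (congrArg Subtype.val (mem_singleton_iff.1 h0)).symm
  exact (finite_of_compact_of_discrete : Finite H)

end STorus

/-! ### CM-fields with a prime of S not alone above its restriction -/

section SplitPrime

open HeightOneSpectrum

variable {K : Type u} [Field K] [NumberField K] {S₀ : Finset (HeightOneSpectrum (𝓞 K))}

/-- The projection of `∏_{w ∈ S} K_w` to `K_v ⊆ ℂ` for an infinite prime `v`. -/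
noncomputable def complexProj (S₀ : Finset (HeightOneSpectrum (𝓞 K))) (v : InfinitePlace K) :
    SCompletion K S₀ →+* ℂ :=
  (InfinitePlace.Completion.extensionEmbedding v).comp
    ((Pi.evalRingHom (fun v : InfinitePlace K => v.Completion) v).comp
      (RingHom.fst (InfiniteAdeleRing K) ((v : S₀) → v.1.adicCompletion K)))

open Classical in
/-- The inclusion of `K_v = ℂ` in `∏_{w ∈ S} K_w` for an infinite prime `v`. -/
noncomputable def complexIncl [IsTotallyComplex K] (S₀ : Finset (HeightOneSpectrum (𝓞 K)))
    (v : InfinitePlace K) : ℂ →+ SCompletion K S₀ :=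
  (AddMonoidHom.inl (InfiniteAdeleRing K) ((v : S₀) → v.1.adicCompletion K)).comp
    ((AddMonoidHom.single (fun v : InfinitePlace K => v.Completion) v).comp
      (InfinitePlace.Completion.ringEquivComplexOfIsComplex
        (IsTotallyComplex.isComplex v)).symm.toAddMonoidHom)

lemma complexProj_apply (v : InfinitePlace K) (x : SCompletion K S₀) :
    complexProj S₀ v x = InfinitePlace.Completion.extensionEmbedding v (x.1 v) := rfl

lemma complexProj_algebraMap (v : InfinitePlace K) (x : K) :
    complexProj S₀ v (algebraMap K (SCompletion K S₀) x) = v.embedding x :=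
  InfinitePlace.Completion.extensionEmbedding_coe v _

lemma norm_complexProj_algebraMap (v : InfinitePlace K) (x : K) :
    ‖complexProj S₀ v (algebraMap K (SCompletion K S₀) x)‖ = v x := by
  rw [complexProj_algebraMap, InfinitePlace.norm_embedding_eq]

lemma continuous_complexProj (v : InfinitePlace K) : Continuous (complexProj S₀ v) :=
  (InfinitePlace.Completion.isometry_extensionEmbedding v).continuous.comp
    ((continuous_apply (A := fun v : InfinitePlace K => v.Completion) v).comp continuous_fst)

section TotallyComplex

variable [IsTotallyComplex K]

lemma complexIncl_fst_self (v : InfinitePlace K) (z : ℂ) : (complexIncl S₀ v z).1 v =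
    (InfinitePlace.Completion.ringEquivComplexOfIsComplex
      (IsTotallyComplex.isComplex v)).symm z := by
  classical
  exact Pi.single_eq_same (M := fun v : InfinitePlace K => v.Completion) v _

lemma complexIncl_fst_of_ne {v w : InfinitePlace K} (h : w ≠ v) (z : ℂ) :
    (complexIncl S₀ v z).1 w = 0 := by
  classical
  exact Pi.single_eq_of_ne (M := fun v : InfinitePlace K => v.Completion) h _

lemma continuous_complexIncl (v : InfinitePlace K) : Continuous (complexIncl S₀ v) := by
  classical
  exact Continuous.prodMk
    ((continuous_single (A := fun v : InfinitePlace K => v.Completion) v).comp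
      (InfinitePlace.Completion.isometryEquivComplexOfIsComplex
        (IsTotallyComplex.isComplex v)).symm.continuous) continuous_const

lemma mul_complexIncl (v : InfinitePlace K) (x : SCompletion K S₀) (z : ℂ) :
    x * complexIncl S₀ v z = complexIncl S₀ v (complexProj S₀ v x * z) := by
  refine Prod.ext (funext fun w => ?_) (funext fun P => ?_)
  · change x.1 w * (complexIncl S₀ v z).1 w = _
    rcases eq_or_ne w v with rfl | hw
    · rw [complexIncl_fst_self, complexIncl_fst_self, map_mul, complexProj_apply,
        ← InfinitePlace.Completion.ringEquivComplexOfIsComplex_apply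
          (IsTotallyComplex.isComplex w), RingEquiv.symm_apply_apply]
    · rw [complexIncl_fst_of_ne hw, complexIncl_fst_of_ne hw, mul_zero]
  · exact mul_zero _

end TotallyComplex

lemma tendsto_algebraMap_pow_mul (x : K) (e : SCompletion K S₀)
    (hinf : ∀ w : InfinitePlace K, e.1 w ≠ 0 → w x < 1)
    (hfin : ∀ P : S₀, e.2 P ≠ 0 → P.1.valuation K x < 1) :
    Tendsto (fun k : ℕ => algebraMap K (SCompletion K S₀) x ^ k * e) atTop (𝓝 0) := by
  refine (Prod.tendsto_iff _ _).2 ⟨tendsto_pi_nhds.2 fun w => ?_, tendsto_pi_nhds.2 fun P => ?_⟩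
  · change Tendsto (fun k : ℕ => algebraMap K w.Completion x ^ k * e.1 w) atTop (𝓝 0)
    by_cases h : e.1 w = 0
    · simp only [h, mul_zero, tendsto_const_nhds]
    · have h1 : ‖algebraMap K w.Completion x‖ < 1 :=
        (InfinitePlace.Completion.norm_coe w _).trans_lt (hinf w h)
      simpa using (tendsto_pow_atTop_nhds_zero_of_norm_lt_one h1).mul_const (e.1 w)
  · change Tendsto (fun k : ℕ => algebraMap K (P.1.adicCompletion K) x ^ k * e.2 P) atTop (𝓝 0)
    by_cases h : e.2 P = 0
    · simp only [h, mul_zero, tendsto_const_nhds]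
    · have h1 : ‖algebraMap K (P.1.adicCompletion K) x‖ < 1 := by
        rw [adicCompletion_norm_lt_one_iff, valued_algebraMap_adicCompletion]
        exact hfin P h
      simpa using (tendsto_pow_atTop_nhds_zero_of_norm_lt_one h1).mul_const (e.2 P)

lemma isUnit_of_infinitePlace_le_one {x : 𝓞 K} (hx0 : x ≠ 0)
    (hx : ∀ w : InfinitePlace K, w x ≤ 1) : IsUnit x := by
  have h1 := InfinitePlace.prod_eq_abs_norm (x : K)
  have h2 : ∏ w : InfinitePlace K, w (x : K) ^ w.mult ≤ 1 :=
    Finset.prod_le_one (fun w _ => by positivity) fun w _ => pow_le_one₀ (by positivity) (hx w)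
  rw [h1, ← Algebra.coe_norm_int] at h2
  have h3 : |Algebra.norm ℤ x| ≤ 1 := by exact_mod_cast h2
  have h4 : Algebra.norm ℤ x ≠ 0 := Algebra.norm_ne_zero_iff.2 hx0
  rw [NumberField.isUnit_iff_norm, RingOfIntegers.coe_norm, ← Algebra.coe_norm_int]
  have h5 : |Algebra.norm ℤ x| = 1 := le_antisymm h3 (Int.one_le_abs h4)
  exact_mod_cast h5

/-- A high power of a Dirichlet unit that is small away from v makes the contracting element small
at all w ≠ v. Were it also at most 1 at v, its norm would make it a unit, although it lies in the
primes of S₀. -/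
lemma exists_expanding (hS : S₀.Nonempty) (v : InfinitePlace K) :
    ∃ a : 𝓞 K, a ≠ 0 ∧ 1 < v a ∧ (∀ w : InfinitePlace K, w ≠ v → w a < 1) ∧
      (∀ P ∈ S₀, P.valuation K (a : K) < 1) ∧ ∀ P ∉ S₀, P.valuation K (a : K) = 1 := by
  obtain ⟨ϖ, hϖ0, hϖ1, hϖ2⟩ := exists_contracting S₀
  obtain ⟨ε, hε⟩ := Units.dirichletUnitTheorem.exists_unit K v
  have hlim (w : InfinitePlace K) : ∀ᶠ k : ℕ in atTop, w ≠ v → w ((ε : 𝓞 K) ^ k * ϖ : K) < 1 := by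
    by_cases hw : w = v
    · exact Eventually.of_forall fun _ h => absurd hw h
    have h0 : 0 < w ((ε : 𝓞 K) : K) := (AbsoluteValue.pos_iff w.1).2 (by simp)
    have h1 : w ((ε : 𝓞 K) : K) < 1 := (Real.log_neg_iff h0).1 (hε w hw)
    have h2 := (tendsto_pow_atTop_nhds_zero_of_lt_one h0.le h1).mul_const (w (ϖ : K))
    rw [zero_mul] at h2
    filter_upwards [h2.eventually_lt_const one_pos] with k hk _
    rwa [map_mul, map_pow]
  obtain ⟨k, hk⟩ := (eventually_all.2 hlim).exists
  have hcoe : (((ε : 𝓞 K) ^ k * ϖ : 𝓞 K) : K) = (ε : 𝓞 K) ^ k * ϖ := by push_cast; rfl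
  have hval (P : HeightOneSpectrum (𝓞 K)) :
      P.valuation K (((ε : 𝓞 K) ^ k * ϖ : 𝓞 K) : K) = P.valuation K (ϖ : K) := by
    have h1 : P.valuation K ((ε : 𝓞 K) : K) = 1 := by
      rw [valuation_eq_one_iff_notMem]
      exact fun h => P.isPrime.ne_top (Ideal.eq_top_of_isUnit_mem _ h ε.isUnit)
    rw [hcoe, map_mul, map_pow, h1, one_pow, one_mul]
  have ha0 : (ε : 𝓞 K) ^ k * ϖ ≠ 0 := mul_ne_zero (pow_ne_zero _ ε.ne_zero) hϖ0
  have hlt (w : InfinitePlace K) (hw : w ≠ v) : w (((ε : 𝓞 K) ^ k * ϖ : 𝓞 K) : K) < 1 := by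
    rw [hcoe]
    exact hk w hw
  refine ⟨(ε : 𝓞 K) ^ k * ϖ, ha0, ?_, hlt, fun P hP => (hval P).trans_lt (hϖ1 P hP),
    fun P hP => (hval P).trans (hϖ2 P hP)⟩
  by_contra hle
  have hu := isUnit_of_infinitePlace_le_one ha0 fun w => by
    rcases eq_or_ne w v with rfl | hw
    · exact not_lt.1 hle
    · exact (hlt w hw).le
  obtain ⟨P, hP⟩ := hS
  have h1 := (hval P).trans_lt (hϖ1 P hP)
  rw [valuation_lt_one_iff_mem] at h1
  exact P.isPrime.ne_top (Ideal.eq_top_of_isUnit_mem _ h1 hu)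

/-- A generator of a power of a prime that splits over the maximal totally real subfield has no
real power. -/
lemma pow_im_ne_zero [IsCMField K] {P P' : HeightOneSpectrum (𝓞 K)} (hne : P' ≠ P)
    (hunder : P'.asIdeal.under (𝓞 (maximalRealSubfield K)) =
      P.asIdeal.under (𝓞 (maximalRealSubfield K)))
    {c : 𝓞 K} {h : ℕ} (hh : 0 < h) (hc : Ideal.span {c} = P.asIdeal ^ h) (φ : K →+* ℂ) {m : ℕ}
    (hm : 0 < m) : (φ c ^ m).im ≠ 0 := by
  intro him
  rw [← Complex.conj_eq_iff_im, ← map_pow, ← map_pow (algebraMap (𝓞 K) K),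
    ← IsCMField.complexEmbedding_complexConj] at him
  obtain ⟨y, hy⟩ := (IsCMField.RingOfIntegers.complexConj_eq_self_iff K (c ^ m)).1
    (φ.injective him)
  have hy' : algebraMap (𝓞 (maximalRealSubfield K)) (𝓞 K) y = c ^ m := by
    apply RingOfIntegers.coe_injective
    exact hy
  -- A real power of c comes from the real subfield, so it lies in the common restriction of P and
  -- P'. This puts c in P', whereas P is the only prime containing c.
  have hcP : c ∈ P.asIdeal := Ideal.pow_le_self hh.ne' (hc ▸ Ideal.mem_span_singleton_self c)
  have h1 : y ∈ P'.asIdeal.under (𝓞 (maximalRealSubfield K)) := by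
    rw [hunder, Ideal.mem_comap, hy']
    exact Ideal.pow_mem_of_mem _ hcP m hm
  rw [Ideal.mem_comap, hy'] at h1
  have h2 := P'.isPrime.mem_of_pow_mem m h1
  have h3 := valuation_eq_one_of_span_eq hc hne
  rw [valuation_eq_one_iff_notMem] at h3
  exact h3 h2

lemma coe_zpow_mul_zpow (a b : (SInt K S₀)ˣ) (m k : ℤ) :
    (((a ^ m * b ^ k : (SInt K S₀)ˣ) : SInt K S₀) : K) =
      ((a : SInt K S₀) : K) ^ m * ((b : SInt K S₀) : K) ^ k := by
  have h := congrArg Units.val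
    (map_mul (Units.map (algebraMap (SInt K S₀) K).toMonoidHom) (a ^ m) (b ^ k))
  rw [map_zpow, map_zpow, Units.val_mul, Units.val_zpow_eq_zpow_val,
    Units.val_zpow_eq_zpow_val] at h
  exact h

/-- It suffices that b have infinite order and be a unit at some Q in S₀: the valuation at Q then
forces m = 0. With a second infinite place, a Dirichlet unit serves. Otherwise #S ≥ 3 provides Q ≠ P
in S₀, and a generator of a power of P serves. -/
lemma exists_independent {P : HeightOneSpectrum (𝓞 K)} (hP : P ∈ S₀) (h3 : 3 ≤ numPrimes K S₀)
    (v : InfinitePlace K) {a : K} (ha : ∀ Q ∈ S₀, Q.valuation K a < 1) :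
    ∃ b : 𝓞 K, b ≠ 0 ∧ (∀ Q ∉ S₀, Q.valuation K (b : K) = 1) ∧
      ∀ m k : ℤ, a ^ m * (b : K) ^ k = 1 → k = 0 := by
  have key (Q : HeightOneSpectrum (𝓞 K)) (hQ : Q ∈ S₀) (b : K) (hb : Q.valuation K b = 1)
      (hb' : ∀ k : ℤ, b ^ k = 1 → k = 0) (m k : ℤ) (h : a ^ m * b ^ k = 1) : k = 0 := by
    have h1 := congrArg (Q.valuation K) h
    rw [map_mul, map_zpow₀, map_zpow₀, hb, one_zpow, mul_one, map_one,
      zpow_eq_one_iff_right₀ zero_le (ha Q hQ).ne] at h1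
    rw [h1, zpow_zero, one_mul] at h
    exact hb' k h
  by_cases hw : ∃ w : InfinitePlace K, w ≠ v
  · obtain ⟨w, hw⟩ := hw
    obtain ⟨ε, hε⟩ := Units.dirichletUnitTheorem.exists_unit K v
    have h0 : 0 < w ((ε : 𝓞 K) : K) := (AbsoluteValue.pos_iff w.1).2 (by simp)
    have h1 : w ((ε : 𝓞 K) : K) < 1 := (Real.log_neg_iff h0).1 (hε w hw)
    have hval (Q : HeightOneSpectrum (𝓞 K)) : Q.valuation K ((ε : 𝓞 K) : K) = 1 := by
      rw [valuation_eq_one_iff_notMem]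
      exact fun h => Q.isPrime.ne_top (Ideal.eq_top_of_isUnit_mem _ h ε.isUnit)
    refine ⟨ε, ε.ne_zero, fun Q _ => hval Q, key P hP _ (hval P) fun k hk => ?_⟩
    have h2 := congrArg w hk
    rwa [map_zpow₀, map_one, zpow_eq_one_iff_right₀ h0.le h1.ne] at h2
  · have hcard : Fintype.card (InfinitePlace K) ≤ 1 :=
      Fintype.card_le_one_iff.2 fun x y => by
        push Not at hw
        rw [hw x, hw y]
    obtain ⟨Q, hQ, hQP⟩ := Finset.exists_mem_ne (s := S₀) (by unfold numPrimes at h3; omega) P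
    obtain ⟨b, h, hh, hb0, hb⟩ := exists_span_singleton_eq_pow P
    refine ⟨b, hb0, fun R hR => valuation_eq_one_of_span_eq hb ?_,
      key Q hQ _ (valuation_eq_one_of_span_eq hb hQP) fun k hk => ?_⟩
    · rintro rfl
      exact hR hP
    · have h2 := congrArg (P.valuation K) hk
      rwa [map_zpow₀, map_one,
        zpow_eq_one_iff_right₀ zero_le (valuation_lt_one_of_span_eq hh hb).ne] at h2

lemma isExpanding_top [IsCMField K] {P P' : HeightOneSpectrum (𝓞 K)} (hP : P ∈ S₀) (hne : P' ≠ P)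
    (hunder : P'.asIdeal.under (𝓞 (maximalRealSubfield K)) =
      P.asIdeal.under (𝓞 (maximalRealSubfield K))) (h3 : 3 ≤ numPrimes K S₀) :
    IsExpanding (complexProj S₀) (complexIncl S₀) (⊤ : Subgroup (SInt K S₀)ˣ) where
  continuous_p := continuous_complexProj
  continuous_j := continuous_complexIncl
  mul_j := mul_complexIncl
  expand v := by
    obtain ⟨a, ha0, hav, haw, haP, haP'⟩ := exists_expanding ⟨P, hP⟩ v
    refine ⟨sUnit (a : K) (by simpa using ha0) haP', trivial,
      hav.trans_eq (norm_complexProj_algebraMap v _).symm,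
      tendsto_algebraMap_pow_mul (a : K) _ (fun w hw => haw w ?_) fun Q _ => haP Q.1 Q.2⟩
    rintro rfl
    refine hw ?_
    change 1 - (complexIncl S₀ w 1).1 w = 0
    rw [complexIncl_fst_self, map_one, sub_self]
  contract := by
    obtain ⟨a, ha0, haP, haP'⟩ := exists_contracting S₀
    refine ⟨sUnit (a : K) (by simpa using ha0) haP', trivial,
      tendsto_algebraMap_pow_mul (a : K) _ (fun w hw => absurd ?_ hw) fun Q _ => haP Q.1 Q.2⟩
    let f : SCompletion K S₀ →+ w.Completion :=
      (Pi.evalAddMonoidHom (fun v : InfinitePlace K => v.Completion) w).comp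
        (AddMonoidHom.fst (InfiniteAdeleRing K) ((v : S₀) → v.1.adicCompletion K))
    change f (1 - ∑ v, complexIncl S₀ v 1) = 0
    have h1 : ∀ v, v ≠ w → f (complexIncl S₀ v 1) = 0 := fun v hv =>
      complexIncl_fst_of_ne (S₀ := S₀) hv.symm 1
    have h2 : f (complexIncl S₀ w 1) = 1 := by
      change (complexIncl S₀ w 1).1 w = 1
      rw [complexIncl_fst_self, map_one]
    rw [map_sub, map_sum, Finset.sum_eq_single w (fun v _ hv => h1 v hv) (by simp), h2]
    exact sub_self _
  rank v := by
    obtain ⟨a, ha0, hav, haw, haP, haP'⟩ := exists_expanding ⟨P, hP⟩ v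
    have ha0' : (a : K) ≠ 0 := by simpa using ha0
    obtain ⟨b, hb0, hbQ, hb⟩ := exists_independent hP h3 v haP
    refine ⟨sUnit (a : K) ha0' haP', trivial, sUnit (b : K) (by simpa using hb0) hbQ, trivial,
      hav.trans_eq (norm_complexProj_algebraMap v _).symm, fun m k h => hb m k ?_⟩
    have h1 := (complexProj_algebraMap (S₀ := S₀) v _).symm.trans h
    exact (coe_zpow_mul_zpow _ _ m k).symm.trans
      (v.embedding.injective (h1.trans (map_one _).symm))
  rotate v := by
    obtain ⟨c, h, hh, hc0, hc⟩ := exists_span_singleton_eq_pow P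
    refine ⟨sUnit (c : K) (by simpa using hc0) fun Q hQ => valuation_eq_one_of_span_eq hc ?_,
      trivial, fun m hm => ?_⟩
    · rintro rfl
      exact hQ hP
    · have h1 := pow_im_ne_zero hne hunder hh hc v.embedding hm
      rwa [← complexProj_algebraMap (S₀ := S₀)] at h1

theorem torsionTheorem_of_split [IsCMField K] {P P' : HeightOneSpectrum (𝓞 K)} (hP : P ∈ S₀)
    (hne : P' ≠ P) (hunder : P'.asIdeal.under (𝓞 (maximalRealSubfield K)) =
      P.asIdeal.under (𝓞 (maximalRealSubfield K))) : TorsionTheorem K S₀ := by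
  intro h3 𝔞 h𝔞 N hne' hN hinv
  have := compactSpace_sTorus h𝔞
  exact (isExpanding_top hP hne hunder h3).exists_mem_torsion
    (Submodule.continuous_mkQ (diagIdeal 𝔞)) (Submodule.isOpenMap_mkQ (diagIdeal 𝔞))
    (Submodule.mkQ_surjective (diagIdeal 𝔞)) exists_mul_eq_natCast
    (fun n hn => finite_setOf_nsmul_eq_zero h𝔞 hn) (dense_torsion_sTorus h𝔞) hN hne' hinv

end SplitPrime

/-! ### Maps of completions and S-integers in an extension -/

section Extension

open HeightOneSpectrum

variable {F K : Type u} [Field F] [NumberField F] [Field K] [NumberField K] [Algebra F K]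

instance (w : HeightOneSpectrum (𝓞 K)) : w.asIdeal.LiesOver (w.under (𝓞 F)).asIdeal := ⟨rfl⟩

omit [NumberField F] [NumberField K] in
lemma infinitePlace_liesOver_comap (w : InfinitePlace K) :
    w.LiesOver (w.comap (algebraMap F K)) := ⟨rfl⟩

/-- The extension of `F → K` to the completions at `w` and at the prime of `F` below `w`. -/
noncomputable def adicCompletionMap (w : HeightOneSpectrum (𝓞 K)) :
    (w.under (𝓞 F)).adicCompletion F →+* w.adicCompletion K :=
  ((adicCompletion.equiv K w).symm.toRingHom.comp
    (UniformSpace.Completion.mapRingHom _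
      (uniformContinuous_algebraMap_liesOver F K (w.under (𝓞 F)) w).continuous)).comp
    (adicCompletion.equiv F (w.under (𝓞 F))).toRingHom

lemma continuous_adicCompletionMap (w : HeightOneSpectrum (𝓞 K)) :
    Continuous (adicCompletionMap (F := F) w) :=
  (adicCompletion.isUniformInducing_toCompletion K w).isInducing.continuous_iff.2
    (UniformSpace.Completion.continuous_map.comp
      (adicCompletion.isUniformInducing_toCompletion F _).isInducing.continuous)

lemma adicCompletionMap_algebraMap (w : HeightOneSpectrum (𝓞 K)) (x : F) :
    adicCompletionMap (F := F) w (algebraMap F ((w.under (𝓞 F)).adicCompletion F) x) =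
      algebraMap K (w.adicCompletion K) (algebraMap F K x) := by
  apply (adicCompletion.equivCompletion K w).injective
  exact UniformSpace.Completion.mapRingHom_coe
    (uniformContinuous_algebraMap_liesOver F K (w.under (𝓞 F)) w).continuous
    (WithVal.toVal _ x)

omit [NumberField F] [NumberField K] in
lemma completionMap_algebraMap (w : InfinitePlace K) (x : F) :
    letI := infinitePlace_liesOver_comap (F := F) w
    LiesOver.completionMap (v := w.comap (algebraMap F K)) (w := w) (algebraMap F _ x) =
      algebraMap K _ (algebraMap F K x) :=
  letI := infinitePlace_liesOver_comap (F := F) w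
  LiesOver.completionMap_coe (v := w.comap (algebraMap F K)) (w := w) (WithAbs.toAbs _ x)

variable {S : Finset (HeightOneSpectrum (𝓞 F))} {S₀ : Finset (HeightOneSpectrum (𝓞 K))}

/-- The extension of `F → K` to the products of completions. -/
noncomputable def sCompletionMap (hS : ∀ w ∈ S₀, w.under (𝓞 F) ∈ S) :
    SCompletion F S →+* SCompletion K S₀ :=
  RingHom.prod
    ((RingHom.pi (f := fun w : InfinitePlace K => w.Completion) fun w =>
      letI := infinitePlace_liesOver_comap (F := F) w
      (LiesOver.completionMap (v := w.comap (algebraMap F K)) (w := w)).comp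
        (Pi.evalRingHom (fun v : InfinitePlace F => v.Completion) (w.comap (algebraMap F K)))).comp
      (RingHom.fst (InfiniteAdeleRing F) ((v : S) → v.1.adicCompletion F)))
    ((RingHom.pi fun w : S₀ => (adicCompletionMap w.1).comp
      (Pi.evalRingHom (fun v : S => v.1.adicCompletion F) ⟨w.1.under (𝓞 F), hS w.1 w.2⟩)).comp
      (RingHom.snd (InfiniteAdeleRing F) ((v : S) → v.1.adicCompletion F)))

lemma continuous_sCompletionMap (hS : ∀ w ∈ S₀, w.under (𝓞 F) ∈ S) :
    Continuous (sCompletionMap hS) := by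
  refine Continuous.prodMk (continuous_pi fun w => ?_) (continuous_pi fun w => ?_)
  · let := infinitePlace_liesOver_comap (F := F) w
    exact LiesOver.continuous_completionMap.comp
      ((continuous_apply (A := fun v : InfinitePlace F => v.Completion) _).comp continuous_fst)
  · exact (continuous_adicCompletionMap w.1).comp ((continuous_apply _).comp continuous_snd)

lemma sCompletionMap_algebraMap (hS : ∀ w ∈ S₀, w.under (𝓞 F) ∈ S) (x : F) :
    sCompletionMap hS (algebraMap F (SCompletion F S) x) =
      algebraMap K (SCompletion K S₀) (algebraMap F K x) :=
  Prod.ext (funext fun w => completionMap_algebraMap w x)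
    (funext fun w => adicCompletionMap_algebraMap w.1 x)

/-- The inclusion of the ring of `S`-integers of `F` in that of `K`. -/
noncomputable def sIntMap (hS : ∀ w : HeightOneSpectrum (𝓞 K), w.under (𝓞 F) ∈ S → w ∈ S₀) :
    SInt F S →+* SInt K S₀ :=
  ((algebraMap F K).comp (algebraMap (SInt F S) F)).codRestrict (SInt K S₀) fun x w hw => by
    -- The valuation at w restricts to F as a power of the one below, which is at most 1 on x
    -- because the prime below w is outside S.
    refine (valuation_liesOver K (w.under (𝓞 F)) w (x : F)).symm.trans_le ?_
    exact pow_le_one' (x.2 _ fun h => hw (hS w h)) _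

end Extension

/-! ### Descent along a quadratic extension -/

section Reduction

open HeightOneSpectrum

/-- The first projection of N contains a torsion point, killed by some n. The part of N whose first
coordinate is killed by n is again closed and invariant, so the hypothesis applies to its second
coordinates. -/
lemma exists_mem_torsion_prod {R T : Type*} [CommRing R] [AddCommGroup T] [Module R T]
    [TopologicalSpace T] [IsTopologicalAddGroup T] [CompactSpace T] [T2Space T]
    (h : ∀ N : Set T, N.Nonempty → IsClosed N → (∀ ε : Rˣ, ∀ x ∈ N, ε • x ∈ N) →
      ∃ x ∈ N, x ∈ AddCommGroup.torsion T)
    {N : Set (T × T)} (hne : N.Nonempty) (hN : IsClosed N)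
    (hinv : ∀ ε : Rˣ, ∀ x ∈ N, ε • x ∈ N) :
    ∃ x ∈ N, x.1 ∈ AddCommGroup.torsion T ∧ x.2 ∈ AddCommGroup.torsion T := by
  obtain ⟨_, ⟨⟨s, y⟩, hsy, rfl⟩, hs⟩ := h (Prod.fst '' N) (hne.image _)
    (hN.isCompact.image continuous_fst).isClosed (by
      rintro ε _ ⟨x, hx, rfl⟩
      exact ⟨ε • x, hinv ε x hx, rfl⟩)
  obtain ⟨n, hn, hns⟩ := isOfFinAddOrder_iff_nsmul_eq_zero.1 hs
  obtain ⟨_, ⟨x, ⟨hxN, hx0⟩, rfl⟩, hx⟩ := h ((fun x => n • x.2) '' (N ∩ {x | n • x.1 = 0}))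
    ⟨_, ⟨(s, y), ⟨hsy, hns⟩, rfl⟩⟩
    (((hN.inter (isClosed_eq (continuous_fst.const_smul n) continuous_const)).isCompact.image
      (continuous_snd.const_smul n)).isClosed) (by
      rintro ε _ ⟨x, ⟨hx, hx0⟩, rfl⟩
      refine ⟨ε • x, ⟨hinv ε x hx, ?_⟩, ?_⟩
      · change n • ε • x.1 = 0
        rw [smul_comm, show n • x.1 = 0 from hx0, smul_zero]
      · exact smul_comm n ε x.2)
  refine ⟨x, hxN, isOfFinAddOrder_iff_nsmul_eq_zero.2 ⟨n, hn, hx0⟩, ?_⟩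
  obtain ⟨m, hm, hmx⟩ := isOfFinAddOrder_iff_nsmul_eq_zero.1 hx
  exact isOfFinAddOrder_iff_nsmul_eq_zero.2 ⟨m * n, by positivity, by rw [mul_smul, hmx]⟩

variable {F K : Type u} [Field F] [NumberField F] [Field K] [NumberField K] [Algebra F K]
  {S : Finset (HeightOneSpectrum (𝓞 F))} {S₀ : Finset (HeightOneSpectrum (𝓞 K))}

variable (F K) in
-- Any element outside F generates K, and clearing its denominator makes it integral. Integrality is
-- what lets multiplication by α descend to the tori.
lemma exists_integral_generator [Algebra.IsQuadraticExtension F K] :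
    ∃ α : 𝓞 K, ∀ x : K, ∃ a b : F, x = algebraMap F K a + α * algebraMap F K b := by
  have hrank : Module.finrank F K = 2 := Algebra.IsQuadraticExtension.finrank_eq_two F K
  obtain ⟨β, hβ⟩ : ∃ β : K, ∀ a : F, algebraMap F K a ≠ β := by
    by_contra! hall
    have h1 : (⊥ : Subalgebra F K) = ⊤ := eq_top_iff.2 fun x _ => Algebra.mem_bot.2 (hall x)
    rw [Subalgebra.bot_eq_top_iff_finrank_eq_one, hrank] at h1
    omega
  obtain ⟨n, hn, α, hα⟩ := exists_natCast_mul_eq_ringOfIntegers β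
  have hli : LinearIndependent F ![(1 : K), α] := by
    refine LinearIndependent.pair_iff.2 fun s t hst => ?_
    rw [Algebra.smul_def, Algebra.smul_def, mul_one] at hst
    have ht : t = 0 := by
      by_contra ht
      refine hβ (-(s / (t * n))) ?_
      have hnK : (n : K) ≠ 0 := by simpa
      have htK : algebraMap F K t ≠ 0 := by simpa
      rw [← hα] at hst
      rw [map_neg, map_div₀, map_mul, map_natCast]
      field_simp
      linear_combination -hst
    refine ⟨?_, ht⟩
    rw [ht, map_zero, zero_mul, add_zero] at hst
    simpa using hst
  have htop := hli.span_eq_top_of_card_eq_finrank' (by simp [hrank])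
  refine ⟨α, fun x => ?_⟩
  have hx : x ∈ Submodule.span F (range ![(1 : K), α]) := htop ▸ Submodule.mem_top
  rw [Matrix.range_cons, Matrix.range_cons, Matrix.range_empty, union_empty,
    singleton_union, Submodule.mem_span_pair] at hx
  obtain ⟨a, b, rfl⟩ := hx
  exact ⟨a, b, by rw [Algebra.smul_def, Algebra.smul_def, mul_one, mul_comm (α : K)]⟩

/-- Multiplication by `β`, after the embedding of the completions of `F` in those of `K`. -/
noncomputable def mulSCompletionMap
    (hS : ∀ w : HeightOneSpectrum (𝓞 K), w ∈ S₀ ↔ w.under (𝓞 F) ∈ S) (β : 𝓞 K) :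
    SCompletion F S →ₛₗ[sIntMap fun w => (hS w).2] SCompletion K S₀ where
  toFun x := algebraMap K (SCompletion K S₀) β * sCompletionMap (fun w => (hS w).1) x
  map_add' x y := by rw [map_add, mul_add]
  map_smul' c x := by
    have h1 : sCompletionMap (fun w => (hS w).1) (c • x) =
        algebraMap K (SCompletion K S₀) (algebraMap F K c) *
          sCompletionMap (fun w => (hS w).1) x := by
      rw [← sCompletionMap_algebraMap (fun w => (hS w).1), ← map_mul]
      exact congrArg _ (Algebra.smul_def c x)
    rw [h1, mul_left_comm]
    exact (Algebra.smul_def (sIntMap (fun w => (hS w).2) c) _).symm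

lemma mulSCompletionMap_algebraMap
    (hS : ∀ w : HeightOneSpectrum (𝓞 K), w ∈ S₀ ↔ w.under (𝓞 F) ∈ S) (β : 𝓞 K) (x : F) :
    mulSCompletionMap hS β (algebraMap F (SCompletion F S) x) =
      algebraMap K (SCompletion K S₀) (β * algebraMap F K x) := by
  rw [map_mul, ← sCompletionMap_algebraMap (fun w => (hS w).1)]
  rfl

lemma diagIdeal_span_le_comap
    (hS : ∀ w : HeightOneSpectrum (𝓞 K), w ∈ S₀ ↔ w.under (𝓞 F) ∈ S) (β : 𝓞 K)
    {𝔞 : Ideal (SInt K S₀)} {m : ℕ} (hm : (m : SInt K S₀) ∈ 𝔞) :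
    diagIdeal (Ideal.span {(m : SInt F S)}) ≤
      ((diagIdeal 𝔞).mkQ.comp (mulSCompletionMap hS β)).ker := by
  rintro _ ⟨c, hc, rfl⟩
  obtain ⟨d, rfl⟩ := Ideal.mem_span_singleton'.1 hc
  rw [LinearMap.mem_ker, LinearMap.comp_apply, Submodule.mkQ_apply, Submodule.Quotient.mk_eq_zero]
  refine ⟨algebraMap (𝓞 K) (SInt K S₀) β * sIntMap (fun w => (hS w).2) (d * m), ?_,
    (mulSCompletionMap_algebraMap hS β _).symm⟩
  rw [map_mul, map_natCast]
  exact 𝔞.mul_mem_left _ (𝔞.mul_mem_left _ hm)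

/-- Multiplication by `β`, after the embedding of the completions of `F` in those of `K`, as a map
of tori. -/
noncomputable def sTorusMap (hS : ∀ w : HeightOneSpectrum (𝓞 K), w ∈ S₀ ↔ w.under (𝓞 F) ∈ S)
    (β : 𝓞 K) {𝔞 : Ideal (SInt K S₀)} {m : ℕ} (hm : (m : SInt K S₀) ∈ 𝔞) :
    STorus (Ideal.span {(m : SInt F S)}) →ₛₗ[sIntMap fun w => (hS w).2] STorus 𝔞 :=
  (diagIdeal (Ideal.span {(m : SInt F S)})).liftQ
    ((diagIdeal 𝔞).mkQ.comp (mulSCompletionMap hS β)) (diagIdeal_span_le_comap hS β hm)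

lemma continuous_sTorusMap (hS : ∀ w : HeightOneSpectrum (𝓞 K), w ∈ S₀ ↔ w.under (𝓞 F) ∈ S)
    (β : 𝓞 K) {𝔞 : Ideal (SInt K S₀)} {m : ℕ} (hm : (m : SInt K S₀) ∈ 𝔞) :
    Continuous (sTorusMap hS β hm) :=
  (Submodule.isQuotientMap_mkQ _).continuous_iff.2 ((Submodule.continuous_mkQ _).comp
    (continuous_const.mul (continuous_sCompletionMap fun w => (hS w).1)))

lemma sTorusMap_mkQ_algebraMap
    (hS : ∀ w : HeightOneSpectrum (𝓞 K), w ∈ S₀ ↔ w.under (𝓞 F) ∈ S) (β : 𝓞 K)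
    {𝔞 : Ideal (SInt K S₀)} {m : ℕ} (hm : (m : SInt K S₀) ∈ 𝔞) (x : F) :
    sTorusMap hS β hm (Submodule.mkQ _ (algebraMap F (SCompletion F S) x)) =
      (diagIdeal 𝔞).mkQ (algebraMap K (SCompletion K S₀) (β * algebraMap F K x)) :=
  congrArg (diagIdeal 𝔞).mkQ (mulSCompletionMap_algebraMap hS β x)

theorem torsionTheorem_of_quadratic [Algebra.IsQuadraticExtension F K]
    (hS : ∀ w : HeightOneSpectrum (𝓞 K), w ∈ S₀ ↔ w.under (𝓞 F) ∈ S)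
    (hcard : numPrimes F S = numPrimes K S₀) (h : TorsionTheorem F S) : TorsionTheorem K S₀ := by
  intro h3 𝔞 h𝔞 N hne hN hinv
  obtain ⟨m, hm0, hm⟩ := exists_natCast_mem h𝔞
  obtain ⟨α, hα⟩ := exists_integral_generator F K
  have hm' : Ideal.span {(m : SInt F S)} ≠ ⊥ := by
    rw [Ne, Ideal.span_singleton_eq_bot]
    exact_mod_cast hm0
  have hF := h (hcard ▸ h3) _ hm'
  have := compactSpace_sTorus hm'
  have := compactSpace_sTorus h𝔞
  let Ψ : STorus (Ideal.span {(m : SInt F S)}) × STorus (Ideal.span {(m : SInt F S)}) →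
    STorus 𝔞 := fun x => sTorusMap hS 1 hm x.1 + sTorusMap hS α hm x.2
  have hΨ : Continuous Ψ := ((continuous_sTorusMap hS 1 hm).comp continuous_fst).add
    ((continuous_sTorusMap hS α hm).comp continuous_snd)
  -- The image is compact, hence closed, and contains the dense image of K = F + αF.
  have hsurj : Function.Surjective Ψ := by
    rw [← range_eq_univ, ← (isCompact_range hΨ).isClosed.closure_eq]
    refine Dense.closure_eq (((Submodule.mkQ_surjective (diagIdeal 𝔞)).denseRange.comp
      (denseRange_algebraMap_sCompletion K S₀) (Submodule.continuous_mkQ _)).mono ?_)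
    rintro _ ⟨x, rfl⟩
    obtain ⟨a, b, rfl⟩ := hα x
    refine ⟨(Submodule.mkQ _ (algebraMap F (SCompletion F S) a),
      Submodule.mkQ _ (algebraMap F (SCompletion F S) b)), ?_⟩
    change sTorusMap hS 1 hm _ + sTorusMap hS α hm _ = _
    rw [sTorusMap_mkQ_algebraMap, sTorusMap_mkQ_algebraMap, ← map_add, ← map_add,
      show ((1 : 𝓞 K) : K) = 1 from map_one _, one_mul]
    rfl
  obtain ⟨x, hxN, hx1, hx2⟩ := exists_mem_torsion_prod hF (hne.preimage hsurj) (hN.preimage hΨ)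
    fun ε x hx => by
      have h1 : Ψ (ε • x) = Units.map (sIntMap fun w => (hS w).2).toMonoidHom ε • Ψ x := by
        have h2 (β : 𝓞 K) (y : STorus (Ideal.span {(m : SInt F S)})) :
            sTorusMap hS β hm (ε • y) =
              Units.map (sIntMap fun w => (hS w).2).toMonoidHom ε • sTorusMap hS β hm y :=
          map_smulₛₗ (sTorusMap hS β hm) (ε : SInt F S) y
        change sTorusMap hS 1 hm (ε • x.1) + sTorusMap hS α hm (ε • x.2) = _
        rw [h2, h2, ← smul_add]
      rw [mem_preimage, h1]
      exact hinv _ _ hx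
  exact ⟨Ψ x, hxN, add_mem
    ((sTorusMap hS 1 hm).toAddMonoidHom.isOfFinAddOrder hx1)
    ((sTorusMap hS α hm).toAddMonoidHom.isOfFinAddOrder hx2)⟩

end Reduction

/-! ### The case distinction -/

theorem mainTheorem9
    (h : ∀ (K : Type u) [Field K] [NumberField K] (S₀ : Finset (HeightOneSpectrum (𝓞 K))),
      ¬ (IsCMField K ∧ LieOverDistinct K S₀) → TorsionTheorem K S₀) :
    ∀ (K : Type u) [Field K] [NumberField K] (S₀ : Finset (HeightOneSpectrum (𝓞 K))),
      TorsionTheorem K S₀ := by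
  classical
  intro K _ _ S₀
  by_cases hCM : IsCMField K
  swap
  · exact h K S₀ fun hK => hCM hK.1
  -- P' ranges over all finite primes, not only those in S: this makes S₀ the full preimage of its
  -- image below, as the descent needs, and the opposite case still gives irrational rotations.
  by_cases hsplit : ∀ P ∈ S₀, ∀ P' : HeightOneSpectrum (𝓞 K),
    P'.asIdeal.under (𝓞 (maximalRealSubfield K)) =
      P.asIdeal.under (𝓞 (maximalRealSubfield K)) → P' = P
  swap
  · push Not at hsplit
    obtain ⟨P, hP, P', hunder, hne⟩ := hsplit
    exact torsionTheorem_of_split hP hne hunder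
  have hinj : ∀ P ∈ S₀, ∀ P' : HeightOneSpectrum (𝓞 K),
      P'.under (𝓞 (maximalRealSubfield K)) = P.under (𝓞 (maximalRealSubfield K)) → P' = P :=
    fun P hP P' hPP' => hsplit P hP P' (congrArg HeightOneSpectrum.asIdeal hPP')
  refine torsionTheorem_of_quadratic (F := maximalRealSubfield K)
    (S := S₀.image (HeightOneSpectrum.under (𝓞 (maximalRealSubfield K)))) (fun w => ?_) ?_
    (h _ _ fun hF => ?_)
  · refine ⟨Finset.mem_image_of_mem _, fun hw => ?_⟩
    obtain ⟨P, hP, hPw⟩ := Finset.mem_image.1 hw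
    rwa [hinj P hP w hPw.symm]
  · rw [numPrimes, numPrimes, IsCMField.card_infinitePlace_eq_card_infinitePlace,
      Finset.card_image_of_injOn fun P _ Q hQ hPQ => hinj Q hQ P hPQ]
  -- The maximal real subfield is totally real, so it cannot be CM, and the hypothesis covers it.
  · have := hF.1
    obtain ⟨v⟩ : Nonempty (InfinitePlace (maximalRealSubfield K)) := inferInstance
    exact InfinitePlace.not_isComplex_iff_isReal.2 (IsTotallyReal.isReal v)
      (IsTotallyComplex.isComplex v)
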